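/- Let $(R,\mathfrak m)$ be a Cohen–Macaulay (Noetherian) local ring of dimension $d\ge 2$ with infinite residue field, and let $I_1,I_2$ be $\mathfrak m$-primary ideals of $R$. An element $x\in I_2$ is called superficial for $I_2$ and $I_1$ if there is $r_0>0$ with $xR\cap I_1^sI_2^r=xI_1^sI_2^{r-1}$ for all $r\ge r_0$ and $s\ge 0$; a sequence $x_1,\dots,x_k$ is called superficial for $I_2$ and $I_1$ if for each $i$ the image of $x_i$ in $R/(x_1,\dots,x_{i-1})$ is superficial for the images of $I_2$ and $I_1$. Let $x_1,\dots,x_d$ be a superficial sequence for $I_2$ and $I_1$ such that $(\mathbf x_d):=(x_1,\dots,x_d)$ is a minimal reduction of $I_2$. Suppose that $(\mathbf x_d)\subseteq I_1$ and $(\mathbf x_d)\cap I_1I_2=(\mathbf x_d)I_1$. Write $\ell$ for length. Define $e_i(I_2)$ ($0\le i\le d$) and $f_{i,I_1}(I_2)$ ($0\le i\le d-1$) by requiring, for all large $n$, $$\ell(R/I_2^n)=\sum_{i=0}^{d}(-1)^ie_i(I_2)\binom{n+d-1-i}{d-i},\qquad \ell(I_2^n/I_1I_2^n)=\sum_{i=0}^{d-1}(-1)^if_{i,I_1}(I_2)\binom{n+d-1-i}{d-1-i},$$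 so that $f_{0,I_1}(I_2)$ is the multiplicity of the fiber cone $F_{I_1}(I_2)=\bigoplus_{n\ge0}I_2^n/I_1I_2^n$. Let $$G_{I_1}(I_2)=R/I_1\oplus\bigoplus_{n\ge1}I_1I_2^{n-1}/I_1I_2^{n},$$ the associated graded module of the filtration $R\supseteq I_1\supseteq I_1I_2\supseteq I_1I_2^2\supseteq\cdots$, a graded module over the Rees algebra $\bigoplus_{n\ge 0}(I_1\cap I_2)^nt^n$ (the Rees algebra of $I_2$ if $I_2\subseteq I_1$). Its depth is taken with respect to the homogeneous maximal ideal $\mathfrak m\oplus\bigoplus_{n\ge1}(I_1\cap I_2)^nt^n$ of this algebra, and it is Cohen–Macaulay if its depth equals its dimension. Then: 1. $$f_{0,I_1}(I_2)\le e_1(I_2)-e_0(I_2)+\ell(I_2/I_1I_2)+\ell(R/I_2)-(d-1)\,\ell(R/I_1),$$ and equality holds if and only if $G_{I_1}(I_2)$ is Cohen–Macaulay and $I_1I_2^n+(\mathbf x_d)=(\mathbf x_d)$ for all $n\ge2$. 2. $$f_{0,I_1}(I_2)\ge e_1(I_2)-\sum_{n\ge1}\ell\bigl(I_1I_2^n/(\mathbf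 x_d)I_1I_2^{n-1}\bigr)+\ell(R/I_1),$$ where only finitely many terms of the sum are nonzero, and equality holds if and only if $\operatorname{depth}G_{I_1}(I_2)\ge d-1$. -/

import Mathlib

namespace FiberCone

universe u v

section Depth

variable {A : Type u} [CommRing A]

/-- The depth of the module `M` with respect to the ideal `𝔞`: the supremum of the lengths of the
`M`-regular sequences consisting of elements of `𝔞`. -/
noncomputable def depth (𝔞 : Ideal A) (M : Type v) [AddCommGroup M] [Module A M] : ℕ∞ :=
  ⨆ rs : {rs : List A // (∀ r ∈ rs, r ∈ 𝔞) ∧ RingTheory.Sequence.IsRegular M rs},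
    (rs.1.length : ℕ∞)

/-- A Noetherian local ring `(A, 𝔪)` is Cohen-Macaulay if its depth equals its dimension. -/
def IsCohenMacaulayLocalRing (A : Type u) [CommRing A] [IsLocalRing A] : Prop :=
  IsNoetherianRing A ∧ (depth (IsLocalRing.maximalIdeal A) A : WithBot ℕ∞) = ringKrullDim A

end Depth

section Ideals

variable {R : Type u} [CommRing R]

/-- The length `ℓ(I / J)` (used for `J ≤ I` with `I / J` of finite length). -/
noncomputable def relLength (I J : Ideal R) : ℕ :=
  (Module.length R (I ⧸ J.submoduleOf I)).toNat

/-- The length `ℓ(R / I)` (used for `R / I` of finite length). -/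
noncomputable def colength (I : Ideal R) : ℕ :=
  (Module.length R (R ⧸ I)).toNat

/-- `J` is a reduction of `I`. -/
def IsReduction (J I : Ideal R) : Prop :=
  J ≤ I ∧ ∃ n : ℕ, J * I ^ n = I ^ (n + 1)

/-- `J` is a minimal reduction of `I`: a reduction minimal with respect to inclusion. -/
def IsMinimalReduction (J I : Ideal R) : Prop :=
  IsReduction J I ∧ ∀ J' : Ideal R, J' ≤ J → IsReduction J' I → J' = J

/-- The element `x ∈ I₂` is superficial for `I₂` and `I₁`: there is `r₀ > 0` such that
`xR ∩ I₁ˢ I₂ʳ = x I₁ˢ I₂ʳ⁻¹` for all `r ≥ r₀` and all `s ≥ 0`. -/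
def IsSuperficial (I₂ I₁ : Ideal R) (x : R) : Prop :=
  x ∈ I₂ ∧ ∃ r₀ : ℕ, 0 < r₀ ∧ ∀ r : ℕ, r₀ ≤ r → ∀ s : ℕ,
    Ideal.span {x} ⊓ I₁ ^ s * I₂ ^ r = Ideal.span {x} * (I₁ ^ s * I₂ ^ (r - 1))

/-- The ideal `(x₁, …, x_{i-1})` generated by the entries before `xᵢ`. -/
def prevIdeal {k : ℕ} (x : Fin k → R) (i : Fin k) : Ideal R :=
  Ideal.span (x '' {j | j < i})

/-- `x₁, …, x_k` is a superficial sequence for `I₂` and `I₁`: for each `i`, the image of `xᵢ` in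
`R / (x₁, …, x_{i-1})` is superficial for the images of `I₂` and `I₁`. -/
def IsSuperficialSequence (I₂ I₁ : Ideal R) {k : ℕ} (x : Fin k → R) : Prop :=
  ∀ i : Fin k,
    IsSuperficial (I₂.map (Ideal.Quotient.mk (prevIdeal x i)))
      (I₁.map (Ideal.Quotient.mk (prevIdeal x i))) (Ideal.Quotient.mk (prevIdeal x i) (x i))

end Ideals

section Graded

variable {R : Type u} [CommRing R]

/-- The filtration shifted by one step, `n ↦ F_{n+1}`. -/
def shift {K : Ideal R} {M : Type v} [AddCommGroup M] [Module R M] (F : K.Filtration M) :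
    K.Filtration M where
  N n := F.N (n + 1)
  mono n := F.mono (n + 1)
  smul_le n := F.smul_le (n + 1)

/-- The quotient module `S / T` of submodules `T ≤ S` of a module. -/
def SubQuotient {A : Type u} [CommRing A] {M : Type v} [AddCommGroup M] [Module A M]
    (S T : Submodule A M) : Type v :=
  S ⧸ T.submoduleOf S

instance {A : Type u} [CommRing A] {M : Type v} [AddCommGroup M] [Module A M]
    (S T : Submodule A M) : AddCommGroup (SubQuotient S T) :=
  inferInstanceAs (AddCommGroup (S ⧸ T.submoduleOf S))

instance {A : Type u} [CommRing A] {M : Type v} [AddCommGroup M] [Module A M]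
    (S T : Submodule A M) : Module A (SubQuotient S T) :=
  inferInstanceAs (Module A (S ⧸ T.submoduleOf S))

/-- The associated graded module `⨁ₙ Fₙ / Fₙ₊₁` of a `K`-filtration `F`, as a module over the
Rees algebra `⨁ₙ Kⁿ tⁿ`: it is the quotient of `⨁ₙ Fₙ tⁿ` by `⨁ₙ Fₙ₊₁ tⁿ`. -/
abbrev AssocGraded {K : Ideal R} {M : Type v} [AddCommGroup M] [Module R M]
    (F : K.Filtration M) : Type v :=
  SubQuotient F.submodule (shift F).submodule

/-- The filtration `R ⊇ I₁ ⊇ I₁I₂ ⊇ I₁I₂² ⊇ ⋯`. It is a filtration with respect to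
`I₁ ⊓ I₂`, which is `I₂` when `I₂ ≤ I₁`. -/
def fiberFiltration (I₁ I₂ : Ideal R) : (I₁ ⊓ I₂).Filtration R where
  N n := Nat.casesOn n (⊤ : Ideal R) (fun m => I₁ * I₂ ^ m)
  mono n := by
    cases n with
    | zero => exact le_top
    | succ m => exact Ideal.mul_mono_right (Ideal.pow_le_pow_right (Nat.le_succ m))
  smul_le n := by
    cases n with
    | zero =>
      change (I₁ ⊓ I₂) * (⊤ : Ideal R) ≤ I₁ * I₂ ^ 0
      simp
    | succ m =>
      change (I₁ ⊓ I₂) * (I₁ * I₂ ^ m) ≤ I₁ * I₂ ^ (m + 1)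
      calc (I₁ ⊓ I₂) * (I₁ * I₂ ^ m) ≤ I₂ * (I₁ * I₂ ^ m) := Ideal.mul_mono_left inf_le_right
        _ = I₁ * I₂ ^ (m + 1) := by ring

/-- `G_{I₁}(I₂) = R/I₁ ⊕ ⨁_{n ≥ 1} I₁I₂ⁿ⁻¹ / I₁I₂ⁿ`. -/
abbrev G (I₁ I₂ : Ideal R) : Type u := AssocGraded (fiberFiltration I₁ I₂)

/-- The homogeneous maximal ideal `𝔪 ⊕ ⨁_{n ≥ 1} Kⁿ tⁿ` of the Rees algebra of `K`. -/
noncomputable def reesMaximalIdeal [IsLocalRing R] (K : Ideal R) : Ideal (reesAlgebra K) :=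
  (IsLocalRing.maximalIdeal R).comap
    ((Polynomial.constantCoeff (R := R)).comp (reesAlgebra K).val.toRingHom)

/-- The depth of the graded module `G_{I₁}(I₂)`, with respect to the homogeneous maximal ideal. -/
noncomputable def depthG [IsLocalRing R] (I₁ I₂ : Ideal R) : ℕ∞ :=
  depth (reesMaximalIdeal (I₁ ⊓ I₂)) (G I₁ I₂)

/-- `G_{I₁}(I₂)` is Cohen-Macaulay: its depth equals its dimension. -/
def IsCohenMacaulayG [IsLocalRing R] (I₁ I₂ : Ideal R) : Prop :=
  (depthG I₁ I₂ : WithBot ℕ∞) = Module.supportDim (reesAlgebra (I₁ ⊓ I₂)) (G I₁ I₂)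

end Graded

section Hilbert

/-- `H(n) = ∑_{i=0}^{D} (-1)ⁱ cᵢ \binom{n+D-i}{D-i}` for all large `n`. -/
def IsHilbertCoeffs (H : ℕ → ℕ) (D : ℕ) (c : ℕ → ℤ) : Prop :=
  ∀ᶠ n : ℕ in Filter.atTop,
    (H n : ℤ) = ∑ i ∈ Finset.range (D + 1), (-1) ^ i * c i * ((n + D - i).choose (D - i) : ℤ)

open Classical in
/-- The `i`-th normalized coefficient (`0 ≤ i ≤ D`) of the Hilbert polynomial of degree at most
`D` of a numerical function `H`. -/
noncomputable def hilbertCoeff (H : ℕ → ℕ) (D : ℕ) (i : ℕ) : ℤ :=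
  if h : ∃ c : ℕ → ℤ, IsHilbertCoeffs H D c then h.choose i else 0

variable {R : Type u} [CommRing R]

/-- The Hilbert coefficients `eᵢ(I)`, `0 ≤ i ≤ d`:
`ℓ(R/Iⁿ) = ∑_{i=0}^{d} (-1)ⁱ eᵢ(I) \binom{n+d-1-i}{d-i}` for large `n`, `d` the dimension of the
ring; equivalently `ℓ(R/Iⁿ⁺¹) = ∑_{i=0}^{d} (-1)ⁱ eᵢ(I) \binom{n+d-i}{d-i}`. -/
noncomputable def e (d : ℕ) (I : Ideal R) (i : ℕ) : ℤ :=
  hilbertCoeff (fun n => colength (I ^ (n + 1))) d i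

/-- The Hilbert coefficients `fᵢ`, `0 ≤ i ≤ d - 1`, of the fiber cone
`F_{I₁}(I₂) = ⨁ₙ I₂ⁿ / I₁I₂ⁿ`:
`ℓ(I₂ⁿ/I₁I₂ⁿ) = ∑_{i=0}^{d-1} (-1)ⁱ fᵢ \binom{n+d-1-i}{d-1-i}` for large `n`. -/
noncomputable def f (d : ℕ) (I₁ I₂ : Ideal R) (i : ℕ) : ℤ :=
  hilbertCoeff (fun n => relLength (I₂ ^ n) (I₁ * I₂ ^ n)) (d - 1) i

end Hilbert

end FiberCone

/-! Both statements are bounds for one number, the first Hilbert coefficient of the filtration F: R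
⊇ I₁ ⊇ I₁I₂ ⊇ ⋯. Write d = m + 1, L_k = (x₀, …, x_{k-1}) and J = L_d.

Cohen–Macaulayness makes x a regular sequence. For any filtration F with x superficial and regular,
reducing modulo x_k differences the Hilbert function in large degrees (`colength_family`). After m
reductions J is principal, generated by a nonzerodivisor, and ℓ(R/(F_n + L_m)) = nℓ(R/J) − ∑ v_j for
large n, where v_j is the length of F_{j+1}/JF_j modulo L_m (`sectionLength`). Hence e₀ = ℓ(R/J) and
e₁(F) = ∑ v_j. Applied to F and to the powers of I₂, with ℓ(I₂ⁿ/I₁I₂ⁿ) = ℓ(R/F_{n+1}) − ℓ(R/I₂ⁿ),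
this gives f₀ = ℓ(R/J) + e₁(I₂) − ∑ v_j.

Each v_j lies between ℓ((F_{j+1} + J)/J) and ℓ(F_{j+1}/JF_j). Summing the upper bounds yields the
second statement. Keeping only j = 0, 1 among the lower bounds yields the first: the discarded terms
vanish exactly when F_n ⊆ J for n ≥ 3, and J ∩ I₁I₂ = JI₁ evaluates the term j = 1, because J/JI₁
has length dℓ(R/I₁).

Equality is governed by the initial forms of the x_k. All upper bounds are attained iff those of x₀,
…, x_{m-1} form a regular sequence on G, and all lower bounds iff those of x₀, …, x_m do. The tools
are the Valabrega–Valla criterion and Sally's descent. That regularity of the first k initial forms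
means depth G ≥ k follows because any regular element of the homogeneous maximal ideal forces the
next initial form to be regular, while Ext vanishing lets the one replace the other. Finally dim G =
d as soon as depth G equals either d or dim G. -/

namespace FiberCone

/-! ### Lengths of quotients by ideals -/

section Length

variable {R : Type*} [CommRing R]

/-- The quotient by `I` has finite length. -/
def FiniteColength (I : Ideal R) : Prop := Module.length R (R ⧸ I) ≠ ⊤

/-- Additivity along 0 → M/p → N/q → N/q' → 0. The map `f` will be an inclusion of ideals or
multiplication by an element. -/
theorem length_quotient_of_comap {M N : Type*} [AddCommGroup M] [Module R M] [AddCommGroup N]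
    [Module R N] (f : M →ₗ[R] N) {p : Submodule R M} {q q' : Submodule R N}
    (hp : ∀ m, m ∈ p ↔ f m ∈ q) (hq : q' = q ⊔ LinearMap.range f) :
    Module.length R (N ⧸ q) = Module.length R (M ⧸ p) + Module.length R (N ⧸ q') := by
  have hle : p ≤ q.comap f := fun m hm => (hp m).1 hm
  have hqq : q ≤ q' := hq ▸ le_sup_left
  refine Module.length_eq_add_of_exact (p.mapQ q f hle) (Submodule.factor hqq) ?_
    (Submodule.factor_surjective hqq) ?_
  · refine LinearMap.ker_eq_bot.1 (LinearMap.ker_eq_bot'.2 fun a ha => ?_)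
    obtain ⟨a, rfl⟩ := p.mkQ_surjective a
    rw [Submodule.mkQ_apply, Submodule.mapQ_apply, Submodule.Quotient.mk_eq_zero, ← hp] at ha
    rwa [Submodule.mkQ_apply, Submodule.Quotient.mk_eq_zero]
  · intro a
    obtain ⟨a, rfl⟩ := q.mkQ_surjective a
    rw [Submodule.factor_mk, Submodule.mkQ_apply, Submodule.Quotient.mk_eq_zero, hq]
    constructor
    · intro ha
      obtain ⟨i, hi, j, ⟨c, rfl⟩, rfl⟩ := Submodule.mem_sup.1 ha
      refine ⟨Submodule.Quotient.mk c, ?_⟩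
      rw [Submodule.mapQ_apply, Submodule.mkQ_apply, Submodule.Quotient.eq]
      simpa using hi
    · rintro ⟨b, hb⟩
      obtain ⟨b, rfl⟩ := p.mkQ_surjective b
      rw [Submodule.mkQ_apply, Submodule.mapQ_apply, Submodule.mkQ_apply,
        Submodule.Quotient.eq] at hb
      have h1 := Submodule.sub_mem (q ⊔ LinearMap.range f)
        (Submodule.mem_sup_right ⟨b, rfl⟩) (Submodule.mem_sup_left hb)
      simpa using h1

theorem length_quotient_eq_add {I J : Ideal R} (h : J ≤ I) :
    Module.length R (R ⧸ J) = Module.length R (I ⧸ J.submoduleOf I) + Module.length R (R ⧸ I) :=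
  length_quotient_of_comap I.subtype (fun _ => Iff.rfl)
    (by rw [Submodule.range_subtype, sup_eq_right.2 h])

theorem FiniteColength.mono {I J : Ideal R} (hJ : FiniteColength J) (h : J ≤ I) :
    FiniteColength I := by
  intro hI
  apply hJ
  rw [length_quotient_eq_add h, hI, add_top]

theorem colength_eq_add {I J : Ideal R} (hJ : FiniteColength J) (h : J ≤ I) :
    colength J = relLength I J + colength I := by
  have h1 := length_quotient_eq_add h
  have hI : Module.length R (R ⧸ I) ≠ ⊤ := hJ.mono h
  have hIJ : Module.length R (I ⧸ J.submoduleOf I) ≠ ⊤ := by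
    intro h'
    apply hJ
    rw [h1, h', top_add]
  rw [colength, relLength, colength, h1, ENat.toNat_add hIJ hI]

theorem colength_le {I J : Ideal R} (hJ : FiniteColength J) (h : J ≤ I) :
    colength I ≤ colength J := by
  rw [colength_eq_add hJ h]; omega

theorem eq_of_colength_eq {I J : Ideal R} (hJ : FiniteColength J) (h : J ≤ I)
    (he : colength I = colength J) : I = J := by
  have h1 := colength_eq_add hJ h
  have h2 : relLength I J = 0 := by omega
  have hIJ : Module.length R (I ⧸ J.submoduleOf I) ≠ ⊤ := by
    intro h'
    apply hJ
    rw [length_quotient_eq_add h, h', top_add]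
  rw [relLength, ENat.toNat_eq_zero, or_iff_left hIJ, Module.length_eq_zero_iff,
    Submodule.Quotient.subsingleton_iff, Submodule.submoduleOf, Submodule.comap_subtype_eq_top] at h2
  exact le_antisymm h2 h

theorem colength_top : colength (⊤ : Ideal R) = 0 := by
  have : Module.length R (R ⧸ (⊤ : Ideal R)) = 0 :=
    Module.length_eq_zero_iff.mpr (Submodule.Quotient.subsingleton_iff.2 rfl)
  rw [colength, this]
  rfl

/-- Multiplication by x embeds R/(I : x) in R/I with cokernel R/(I + xR). -/
theorem colength_colon {I Q : Ideal R} (x : R) (hI : FiniteColength I)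
    (hQ : ∀ r, r ∈ Q ↔ x * r ∈ I) :
    colength I = colength (I ⊔ Ideal.span {x}) + colength Q := by
  have hle : I ≤ Q := fun r hr => (hQ r).2 (I.mul_mem_left x hr)
  have key : Module.length R (R ⧸ I) =
      Module.length R (R ⧸ Q) + Module.length R (R ⧸ I ⊔ Ideal.span {x}) :=
    length_quotient_of_comap (LinearMap.mulLeft R x) hQ
      (congrArg (I ⊔ ·) (by ext a; simp [Ideal.mem_span_singleton', mul_comm]))
  have h1 := hI.mono hle
  have h2 := hI.mono (I := I ⊔ Ideal.span {x}) le_sup_left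
  rw [colength, colength, colength, key, ENat.toNat_add h1 h2, add_comm]

theorem relLength_sup_inf (I J : Ideal R) : relLength (I ⊔ J) J = relLength I (I ⊓ J) := by
  unfold relLength
  congr 1
  refine LinearEquiv.length_eq (LinearEquiv.symm (LinearEquiv.trans (Submodule.quotEquivOfEq _ _ ?_)
    (LinearMap.quotientInfEquivSupQuotient I J)))
  ext a
  simp [Submodule.submoduleOf]

theorem colength_sup_add_colength_inf {I J : Ideal R} (h : FiniteColength (I ⊓ J)) :
    colength (I ⊔ J) + colength (I ⊓ J) = colength I + colength J := by
  have h1 := colength_eq_add h (I := I) inf_le_left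
  have h2 := colength_eq_add (h.mono inf_le_right) (le_sup_right : J ≤ I ⊔ J)
  rw [relLength_sup_inf] at h2
  omega

/-- The kernel of B/A → (B + L)/(A + L) is (B ∩ (A + L))/A, which is the whole loss of length. Both
the upper and the lower bound for `sectionLength` are instances. -/
theorem colength_sup_sub_le {A B L : Ideal R} (hA : FiniteColength A) (hAB : A ≤ B) :
    (colength (A ⊔ L) : ℤ) - colength (B ⊔ L) ≤ colength A - colength B ∧
    ((colength (A ⊔ L) : ℤ) - colength (B ⊔ L) = colength A - colength B ↔
      B ⊓ (A ⊔ L) ≤ A) := by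
  have h0 : A ≤ B ⊓ (A ⊔ L) := le_inf hAB le_sup_left
  have h1 := colength_sup_add_colength_inf (hA.mono h0)
  have h2 : B ⊔ (A ⊔ L) = B ⊔ L := by rw [← sup_assoc, sup_eq_left.2 hAB]
  rw [h2] at h1
  have h3 := colength_le hA h0
  refine ⟨by omega, ⟨fun h => (eq_of_colength_eq hA h0 (by omega)).le, fun h => ?_⟩⟩
  rw [le_antisymm h h0] at h1
  omega

end Length

/-! ### Hilbert coefficients and differences of numerical functions -/

section HilbertCoefficients

/-- The integer-valued version of `IsHilbertCoeffs`. -/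
def IsHilbertCoeffsInt (H : ℕ → ℤ) (D : ℕ) (c : ℕ → ℤ) : Prop :=
  ∀ᶠ n : ℕ in Filter.atTop,
    H n = ∑ i ∈ Finset.range (D + 1), (-1) ^ i * c i * ((n + D - i).choose (D - i) : ℤ)

/-- Pascal's rule in each term; the last term is constant and cancels, so the other coefficients
survive unchanged. -/
theorem sum_choose_sub (D : ℕ) (c : ℕ → ℤ) (n : ℕ) :
    ∑ i ∈ Finset.range (D + 2), (-1) ^ i * c i * ((n + 1 + (D + 1) - i).choose (D + 1 - i) : ℤ) -
      ∑ i ∈ Finset.range (D + 2), (-1) ^ i * c i * ((n + (D + 1) - i).choose (D + 1 - i) : ℤ) =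
    ∑ i ∈ Finset.range (D + 1), (-1) ^ i * c i * ((n + 1 + D - i).choose (D - i) : ℤ) := by
  rw [Finset.sum_range_succ, Finset.sum_range_succ _ (D + 1)]
  simp only [Nat.sub_self, Nat.choose_zero_right, add_sub_add_right_eq_sub]
  rw [← Finset.sum_sub_distrib]
  refine Finset.sum_congr rfl fun i hi => ?_
  have hi' : i ≤ D := by simpa [Nat.lt_succ_iff] using hi
  obtain ⟨k, rfl⟩ := Nat.exists_eq_add_of_le hi'
  have h1 : n + 1 + (i + k + 1) - i = n + k + 1 + 1 := by omega
  have h2 : n + (i + k + 1) - i = n + k + 1 := by omega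
  have h3 : n + 1 + (i + k) - i = n + k + 1 := by omega
  have h4 : i + k + 1 - i = k + 1 := by omega
  have h5 : i + k - i = k := by omega
  rw [h1, h2, h3, h4, h5, Nat.choose_succ_succ (n + k + 1) k]
  push_cast
  ring

theorem IsHilbertCoeffsInt.sub {H H' : ℕ → ℤ} {D : ℕ} {c : ℕ → ℤ}
    (h : IsHilbertCoeffsInt H (D + 1) c)
    (hH : ∀ᶠ n in Filter.atTop, H' (n + 1) = H (n + 1) - H n) : IsHilbertCoeffsInt H' D c := by
  unfold IsHilbertCoeffsInt at h ⊢
  rw [← Filter.map_add_atTop_eq_nat 1, Filter.eventually_map]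
  filter_upwards [h, (Filter.tendsto_add_atTop_nat 1).eventually h, hH] with n h1 h2 h3
  rw [h3, h2, h1, sum_choose_sub]

theorem IsHilbertCoeffsInt.exists_of_sub {H H' : ℕ → ℤ} {D : ℕ} {c : ℕ → ℤ}
    (h : IsHilbertCoeffsInt H' D c)
    (hH : ∀ᶠ n in Filter.atTop, H' (n + 1) = H (n + 1) - H n) :
    ∃ c', IsHilbertCoeffsInt H (D + 1) c' := by
  unfold IsHilbertCoeffsInt at h
  rw [← Filter.map_add_atTop_eq_nat 1, Filter.eventually_map] at h
  obtain ⟨N, hN⟩ := Filter.eventually_atTop.1 (h.and hH)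
  set P : (ℕ → ℤ) → ℕ → ℤ := fun c n => ∑ i ∈ Finset.range (D + 2),
    (-1) ^ i * c i * ((n + (D + 1) - i).choose (D + 1 - i) : ℤ) with hP
  -- The last coefficient is the constant of summation, chosen so that the polynomial takes the
  -- value `H N` at `N`.
  set c' : ℕ → ℤ := fun i => if i ≤ D then c i else
    (-1) ^ (D + 1) * (H N - P (fun i => if i ≤ D then c i else 0) N) with hc'
  have hsub : ∀ n, P c' (n + 1) - P c' n = ∑ i ∈ Finset.range (D + 1),
      (-1) ^ i * c i * ((n + 1 + D - i).choose (D - i) : ℤ) := by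
    intro n
    rw [hP]
    simp only
    rw [sum_choose_sub]
    refine Finset.sum_congr rfl fun i hi => ?_
    have hi' : i ≤ D := by simpa [Nat.lt_succ_iff] using hi
    simp only [hc', if_pos hi']
  refine ⟨c', Filter.eventually_atTop.2 ⟨N, fun n hn => ?_⟩⟩
  change H n = P c' n
  induction n, hn using Nat.le_induction with
  | base =>
    have h1 : P c' N = P (fun i => if i ≤ D then c i else 0) N + (-1) ^ (D + 1) * c' (D + 1) := by
      simp only [hP]
      rw [Finset.sum_range_succ, Finset.sum_range_succ _ (D + 1)]
      simp only [Nat.sub_self, Nat.choose_zero_right, Nat.cast_one, mul_one,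
        Nat.not_succ_le_self, if_false, mul_zero, add_zero]
      congr 1
      refine Finset.sum_congr rfl fun i hi => ?_
      have hi' : i ≤ D := by simpa [Nat.lt_succ_iff] using hi
      simp only [hc', if_pos hi']
    rw [h1]
    simp only [hc', Nat.not_succ_le_self, if_false, ← mul_assoc, ← pow_add]
    rw [Even.neg_one_pow ⟨_, rfl⟩]
    ring
  | succ n hn ih =>
    obtain ⟨h1, h2⟩ := hN n hn
    have := hsub n
    linarith

variable {H : ℕ → ℕ → ℤ} {D : ℕ}

theorem IsHilbertCoeffsInt.of_family
    (hH : ∀ k < D, ∀ᶠ n in Filter.atTop, H (k + 1) (n + 1) = H k (n + 1) - H k n)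
    {c : ℕ → ℤ} (hc : IsHilbertCoeffsInt (H 0) D c) {k : ℕ} (hk : k ≤ D) :
    IsHilbertCoeffsInt (H k) (D - k) c := by
  induction k with
  | zero => exact hc
  | succ k ih =>
    have h := ih (by omega)
    rw [show D - k = D - (k + 1) + 1 by omega] at h
    exact h.sub (hH k hk)

theorem exists_isHilbertCoeffsInt_of_family
    (hH : ∀ k < D, ∀ᶠ n in Filter.atTop, H (k + 1) (n + 1) = H k (n + 1) - H k n)
    {k : ℕ} (hk : k ≤ D) (h : ∃ c, IsHilbertCoeffsInt (H k) (D - k) c) :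
    ∃ c, IsHilbertCoeffsInt (H 0) D c := by
  induction k with
  | zero => exact h
  | succ k ih =>
    obtain ⟨c, hc⟩ := h
    refine ih (by omega) ?_
    rw [show D - k = D - (k + 1) + 1 by omega]
    exact hc.exists_of_sub (hH k hk)

theorem isHilbertCoeffs_hilbertCoeff {H : ℕ → ℕ} {D : ℕ} (h : ∃ c, IsHilbertCoeffs H D c) :
    IsHilbertCoeffs H D (hilbertCoeff H D) := by
  have : hilbertCoeff H D = h.choose := by
    funext i
    rw [hilbertCoeff, dif_pos h]
  rw [this]
  exact h.choose_spec

/-- If the `D`-th difference of a numerical function is eventually constant, then this constant is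
its zeroth Hilbert coefficient. -/
theorem hilbertCoeff_zero_of_family {H₀ : ℕ → ℕ} (h0 : ∀ᶠ n in Filter.atTop, H 0 n = H₀ n)
    (hH : ∀ k < D, ∀ᶠ n in Filter.atTop, H (k + 1) (n + 1) = H k (n + 1) - H k n)
    {a : ℤ} (ha : ∀ᶠ n in Filter.atTop, H D n = a) : hilbertCoeff H₀ D 0 = a := by
  have hex : ∃ c, IsHilbertCoeffs H₀ D c := by
    obtain ⟨c, hc⟩ := exists_isHilbertCoeffsInt_of_family hH le_rfl
      ⟨fun _ => a, by
        filter_upwards [ha] with n hn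
        simp [hn]⟩
    refine ⟨c, ?_⟩
    filter_upwards [h0, hc] with n h1 h2
    rw [← h1, h2]
  have h1 : IsHilbertCoeffsInt (H 0) D (hilbertCoeff H₀ D) := by
    filter_upwards [h0, isHilbertCoeffs_hilbertCoeff hex] with n h1 h2
    rw [h1, h2]
  obtain ⟨n, h2, h3⟩ := ((h1.of_family hH le_rfl).and ha).exists
  rw [h3] at h2
  simpa using h2.symm

/-- If the `D`-th difference of a numerical function is eventually `n ↦ a (n + 1) - b`, then `a`
and `b` are its first two Hilbert coefficients. -/
theorem hilbertCoeff_of_family {H₀ : ℕ → ℕ} (h0 : ∀ᶠ n in Filter.atTop, H 0 n = H₀ n)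
    (hH : ∀ k < D, ∀ᶠ n in Filter.atTop, H (k + 1) (n + 1) = H k (n + 1) - H k n)
    {a b : ℤ} (ha : ∀ᶠ n : ℕ in Filter.atTop, H D n = a * (n + 1) - b) :
    hilbertCoeff H₀ (D + 1) 0 = a ∧ hilbertCoeff H₀ (D + 1) 1 = b := by
  have hpoly : ∀ (c : ℕ → ℤ) (n : ℕ), ∑ i ∈ Finset.range (1 + 1),
      (-1) ^ i * c i * ((n + 1 - i).choose (1 - i) : ℤ) = c 0 * (n + 1) - c 1 := by
    intro c n
    simp [Finset.sum_range_succ]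
    ring
  -- The polynomial has degree `D + 1`, one more than the given differences reach; the constant `a`
  -- supplies the missing top difference.
  have hH1 : ∀ k < D + 1, ∀ᶠ n in Filter.atTop,
      (fun k n => if k ≤ D then H k n else a) (k + 1) (n + 1) =
        (fun k n => if k ≤ D then H k n else a) k (n + 1) -
        (fun k n => if k ≤ D then H k n else a) k n := by
    intro k hk
    rcases Nat.lt_succ_iff_lt_or_eq.1 hk with hk | rfl
    · filter_upwards [hH k hk] with n hn
      simp only [if_pos hk.le]
      simpa [Nat.succ_le_of_lt hk] using hn
    · filter_upwards [ha, (Filter.tendsto_add_atTop_nat 1).eventually ha] with n h1 h2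
      simp only [Nat.not_succ_le_self, if_false, le_refl, if_true]
      rw [h1, h2]
      push_cast
      ring
  obtain ⟨c, hc⟩ := exists_isHilbertCoeffsInt_of_family (D := D + 1)
    (H := fun k n => if k ≤ D then H k n else a) hH1 (k := D) (by omega)
    ⟨fun i => if i = 0 then a else b, by
      filter_upwards [ha] with n hn
      rw [Nat.add_sub_cancel_left, hpoly]
      simpa using hn⟩
  have hex : ∃ c, IsHilbertCoeffs H₀ (D + 1) c := by
    refine ⟨c, ?_⟩
    filter_upwards [h0, hc] with n h1 h2
    rw [← h1, ← h2]
    simp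
  have h1 : IsHilbertCoeffsInt ((fun k n => if k ≤ D then H k n else a) 0) (D + 1)
      (hilbertCoeff H₀ (D + 1)) := by
    filter_upwards [h0, isHilbertCoeffs_hilbertCoeff hex] with n h1 h2
    simp [h1, h2]
  have h2 := IsHilbertCoeffsInt.of_family (H := fun k n => if k ≤ D then H k n else a)
    hH1 h1 (k := D) (by omega)
  rw [Nat.add_sub_cancel_left] at h2
  have h3 : ∀ᶠ n : ℕ in Filter.atTop, a * (n + 1) - b =
      hilbertCoeff H₀ (D + 1) 0 * (n + 1) - hilbertCoeff H₀ (D + 1) 1 := by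
    filter_upwards [h2, ha] with n h4 h5
    rw [hpoly] at h4
    simpa [h5] using h4
  -- Two consecutive values determine a polynomial of degree one.
  obtain ⟨n, h4, h5⟩ := (h3.and ((Filter.tendsto_add_atTop_nat 1).eventually h3)).exists
  push_cast at h5
  have h6 : hilbertCoeff H₀ (D + 1) 0 = a := by linarith
  rw [h6] at h4
  exact ⟨h6, by linarith⟩

end HilbertCoefficients

/-! ### Superficial filtrations, Sally's descent, the Valabrega–Valla criterion -/

section Filtration

variable {R : Type*} [CommRing R]

/-- The ideal generated by the first `k` terms of a sequence. -/
def partialIdeal (x : ℕ → R) (k : ℕ) : Ideal R := Ideal.span (x '' Set.Iio k)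

theorem partialIdeal_zero (x : ℕ → R) : partialIdeal x 0 = ⊥ := by simp [partialIdeal]

theorem partialIdeal_succ (x : ℕ → R) (k : ℕ) :
    partialIdeal x (k + 1) = partialIdeal x k ⊔ Ideal.span {x k} := by
  rw [partialIdeal, partialIdeal, ← Ideal.span_union]
  congr 1
  ext a
  simp only [Set.mem_image, Set.mem_Iio, Set.union_singleton, Set.mem_insert_iff]
  constructor
  · rintro ⟨j, hj, rfl⟩
    rcases Nat.lt_succ_iff_lt_or_eq.1 hj with h | rfl
    · exact Or.inr ⟨j, h, rfl⟩
    · exact Or.inl rfl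
  · rintro (rfl | ⟨j, hj, rfl⟩)
    · exact ⟨k, k.lt_succ_self, rfl⟩
    · exact ⟨j, hj.trans k.lt_succ_self, rfl⟩

theorem partialIdeal_mono (x : ℕ → R) : Monotone (partialIdeal x) := fun _ _ h =>
  Ideal.span_mono (Set.image_mono (Set.Iio_subset_Iio h))

theorem mem_partialIdeal (x : ℕ → R) {j k : ℕ} (h : j < k) : x j ∈ partialIdeal x k :=
  Ideal.subset_span ⟨j, h, rfl⟩

theorem mem_partialIdeal_succ {x : ℕ → R} {k : ℕ} {a : R} :
    a ∈ partialIdeal x (k + 1) ↔ ∃ r, a - x k * r ∈ partialIdeal x k := by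
  rw [partialIdeal_succ, Submodule.mem_sup]
  constructor
  · rintro ⟨l, hl, b, hb, rfl⟩
    obtain ⟨r, rfl⟩ := Ideal.mem_span_singleton'.1 hb
    exact ⟨r, by simpa [mul_comm] using hl⟩
  · rintro ⟨r, hr⟩
    exact ⟨_, hr, x k * r, Ideal.mul_mem_right _ _ (Ideal.mem_span_singleton_self _), by ring⟩

/-- A filtration `F` of `R` by ideals of finite colength together with a regular sequence
`x₀, …, x_{d-1}` which is superficial for `F`, raises degrees by one and generates `F` in large
degrees. -/
structure IsSuperficialFiltration (F : ℕ → Ideal R) (x : ℕ → R) (d : ℕ) : Prop where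
  zero : F 0 = ⊤
  anti : Antitone F
  mul_mem : ∀ k < d, ∀ n, ∀ r ∈ F n, x k * r ∈ F (n + 1)
  regular : ∀ k < d, ∀ r, x k * r ∈ partialIdeal x k → r ∈ partialIdeal x k
  superficial : ∀ k < d, ∃ N, ∀ n ≥ N, ∀ r,
    x k * r ∈ F (n + 1) ⊔ partialIdeal x k → r ∈ F n ⊔ partialIdeal x k
  stable : ∃ N, ∀ n ≥ N, F (n + 1) ≤ partialIdeal x d * F n
  finite : ∀ n, FiniteColength (F n)

/-- The initial form of `x_k` is regular on the associated graded module of `F` modulo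
`x₀, …, x_{k-1}`. -/
def RegularInitialForm (F : ℕ → Ideal R) (x : ℕ → R) (k : ℕ) : Prop :=
  ∀ j r, x k * r ∈ F (j + 1) ⊔ partialIdeal x k → r ∈ F j ⊔ partialIdeal x k

namespace IsSuperficialFiltration

variable {F : ℕ → Ideal R} {x : ℕ → R} {d : ℕ} (h : IsSuperficialFiltration F x d)

include h

theorem mul_mem_sup {k : ℕ} (hk : k < d) {n : ℕ} {r : R} {L : Ideal R} (hr : r ∈ F n ⊔ L) :
    x k * r ∈ F (n + 1) ⊔ L := by
  obtain ⟨f, hf, l, hl, rfl⟩ := Submodule.mem_sup.1 hr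
  rw [mul_add]
  exact Submodule.add_mem_sup (h.mul_mem k hk n f hf) (L.mul_mem_left _ hl)

theorem pow_mul_mem_sup {k : ℕ} (hk : k < d) {n : ℕ} {r : R} {L : Ideal R} (hr : r ∈ F n ⊔ L)
    (p : ℕ) : x k ^ p * r ∈ F (n + p) ⊔ L := by
  induction p with
  | zero => simpa using hr
  | succ p ih =>
    rw [pow_succ', mul_assoc, ← add_assoc]
    exact h.mul_mem_sup hk ih

theorem mul_le (n : ℕ) : partialIdeal x d * F n ≤ F (n + 1) := by
  rw [partialIdeal, ← Ideal.span_eq (F n), Ideal.span_mul_span', Ideal.span_le]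
  rintro _ ⟨_, ⟨k, hk, rfl⟩, r, hr, rfl⟩
  exact h.mul_mem k hk n r hr

theorem partialIdeal_le : partialIdeal x d ≤ F 1 := by
  have := h.mul_le 0
  rwa [h.zero, Ideal.mul_top] at this

/-- The bound `N` does not depend on the exponent `n`: every cancellation of x_k takes place in
degree at least `p`. -/
theorem exists_pow_colon_le {k : ℕ} (hk : k < d) : ∃ N, ∀ p ≥ N, ∀ n r,
    x k ^ n * r ∈ F (p + n) ⊔ partialIdeal x k → r ∈ F p ⊔ partialIdeal x k := by
  obtain ⟨N, hN⟩ := h.superficial k hk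
  refine ⟨N, fun p hp n => ?_⟩
  induction n with
  | zero => intro r hr; simpa using hr
  | succ n ih =>
    intro r hr
    refine ih r (hN (p + n) (by omega) _ ?_)
    rwa [← mul_assoc, ← pow_succ']

/-- Sally's descent. -/
theorem regularInitialForm_of_succ {k : ℕ} (hk : k + 1 < d)
    (hC : RegularInitialForm F x (k + 1)) : RegularInitialForm F x k := by
  have hk' : k < d := k.lt_succ_self.trans hk
  have h1 : ∀ p j r, x (k + 1) ^ p * r ∈ F (j + p) ⊔ partialIdeal x (k + 1) →
      r ∈ F j ⊔ partialIdeal x (k + 1) := by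
    intro p
    induction p with
    | zero => intro j r hr; simpa using hr
    | succ p ih =>
      intro j r hr
      refine ih j r (hC (j + p) _ ?_)
      rwa [← mul_assoc, ← pow_succ']
  obtain ⟨N, hN⟩ := h.exists_pow_colon_le hk'
  -- Multiplying by x_{k+1}^N moves r into degrees where x_k is superficial. After x_k^n is
  -- cancelled there, `h1` removes x_{k+1}^N, at the price of working modulo L_{k+1}.
  have h2 : ∀ j n r, x k ^ n * r ∈ F (j + n) ⊔ partialIdeal x k →
      r ∈ F j ⊔ partialIdeal x (k + 1) := by
    intro j n r hr
    refine h1 N j r ?_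
    refine sup_le_sup_left (partialIdeal_mono x k.le_succ) _ (hN (j + N) (by omega) n _ ?_)
    have := h.pow_mul_mem_sup hk hr N
    rw [show j + N + n = j + n + N by omega]
    rwa [mul_left_comm]
  -- To return from L_{k+1} to L_k, write r = f + c x_k with f ∈ F_{j+1} + L_k nothing more to prove
  -- for f, and apply induction to c. The exponent of x_k rises by one as j drops, hence the
  -- quantifier over `n`.
  have h3 : ∀ j n r, x k ^ n * r ∈ F (j + n) ⊔ partialIdeal x k →
      r ∈ F j ⊔ partialIdeal x k := by
    intro j
    induction j with
    | zero => intro n r _; rw [h.zero, top_sup_eq]; trivial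
    | succ j ih =>
      intro n r hr
      have h4 := h2 (j + 1) n r hr
      rw [partialIdeal_succ, ← sup_assoc] at h4
      obtain ⟨f, hf, b, hb, rfl⟩ := Submodule.mem_sup.1 h4
      obtain ⟨c, rfl⟩ := Ideal.mem_span_singleton'.1 hb
      refine Ideal.add_mem _ hf ?_
      rw [mul_comm]
      refine h.mul_mem_sup hk' (ih (n + 1) c ?_)
      have h5 := Ideal.sub_mem _ hr (h.pow_mul_mem_sup hk' hf n)
      rw [show j + (n + 1) = j + 1 + n by omega]
      convert h5 using 1
      ring
  intro j r hr
  exact h3 j 1 r (by simpa using hr)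

theorem regularInitialForm_of_le {k m : ℕ} (hm : m < d) (hC : RegularInitialForm F x m)
    (hkm : k ≤ m) : RegularInitialForm F x k := by
  induction m with
  | zero => rwa [Nat.le_zero.1 hkm]
  | succ m ih =>
    rcases Nat.le_succ_iff_eq_or_le.1 hkm with rfl | hkm
    · exact hC
    · exact ih (by omega) (h.regularInitialForm_of_succ hm hC) hkm

/-- One direction of the criterion of Valabrega and Valla. -/
theorem inf_le_of_regularInitialForm {m : ℕ} (hm : m ≤ d)
    (hC : ∀ k < m, RegularInitialForm F x k) (j : ℕ) :
    partialIdeal x m ⊓ F (j + 1) ≤ partialIdeal x m * F j := by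
  induction m with
  | zero => rw [partialIdeal_zero, bot_inf_eq]; exact bot_le
  | succ m ih =>
    rintro a ⟨ha, haF⟩
    obtain ⟨r, hr⟩ := mem_partialIdeal_succ.1 ha
    have h1 : x m * r ∈ F (j + 1) ⊔ partialIdeal x m := by
      have := Submodule.sub_mem (F (j + 1) ⊔ partialIdeal x m) (Submodule.mem_sup_left haF)
        (Submodule.mem_sup_right hr)
      simpa using this
    obtain ⟨f, hf, l, hl, rfl⟩ := Submodule.mem_sup.1 (hC m m.lt_succ_self j r h1)
    have h2 : a - x m * f ∈ partialIdeal x m ⊓ F (j + 1) := by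
      refine ⟨?_, Ideal.sub_mem _ haF (h.mul_mem m (by omega) j f hf)⟩
      have := Ideal.add_mem _ hr (Ideal.mul_mem_left _ (x m) hl)
      rwa [mul_add, ← sub_sub, sub_add_cancel] at this
    have h3 := ih (by omega) (fun k hk => hC k (by omega)) h2
    have h4 := Ideal.add_mem _ (Ideal.mul_mono_left (partialIdeal_mono x m.le_succ) h3)
      (Ideal.mul_mem_mul (mem_partialIdeal x m.lt_succ_self) hf)
    simpa using h4

omit h in
theorem mul_sup_eq {m : ℕ} (I : Ideal R) :
    partialIdeal x (m + 1) * I ⊔ partialIdeal x m = Ideal.span {x m} * I ⊔ partialIdeal x m := by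
  rw [partialIdeal_succ, Ideal.sup_mul, sup_comm (_ * I), sup_assoc,
    sup_eq_right.2 (Ideal.mul_le_left : partialIdeal x m * I ≤ _)]

omit h in
theorem mem_span_mul_sup {m : ℕ} (hreg : ∀ r, x m * r ∈ partialIdeal x m → r ∈ partialIdeal x m)
    {I : Ideal R} {r : R} :
    x m * r ∈ Ideal.span {x m} * I ⊔ partialIdeal x m ↔ r ∈ I ⊔ partialIdeal x m := by
  constructor
  · intro hr
    obtain ⟨b, hb, l, hl, hbl⟩ := Submodule.mem_sup.1 hr
    obtain ⟨f, hf, rfl⟩ := Ideal.mem_span_singleton_mul.1 hb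
    have h1 : r - f ∈ partialIdeal x m := hreg _ (by
      rw [mul_sub, ← hbl]
      simpa using hl)
    have := Submodule.add_mem_sup hf h1
    simpa using this
  · intro hr
    obtain ⟨f, hf, l, hl, rfl⟩ := Submodule.mem_sup.1 hr
    rw [mul_add]
    exact Submodule.add_mem_sup (Ideal.mul_mem_mul (Ideal.mem_span_singleton_self _) hf)
      (Ideal.mul_mem_left _ _ hl)

/-- The other direction of the criterion of Valabrega and Valla. -/
theorem regularInitialForm_of_inf_le {m : ℕ} (hm : m < d)
    (hV : ∀ j, partialIdeal x (m + 1) ⊓ F (j + 1) ≤ partialIdeal x (m + 1) * F j) :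
    RegularInitialForm F x m := by
  intro j r hr
  obtain ⟨f, hf, l, hl, hfl⟩ := Submodule.mem_sup.1 hr
  rw [← mem_span_mul_sup (h.regular m hm), ← mul_sup_eq, ← hfl]
  refine Submodule.add_mem_sup (hV j ⟨?_, hf⟩) hl
  have : f = x m * r - l := by rw [← hfl]; ring
  rw [this]
  exact Ideal.sub_mem _ (Ideal.mul_mem_right _ _ (mem_partialIdeal x m.lt_succ_self))
    (partialIdeal_mono x m.le_succ hl)

theorem finiteColength_partialIdeal : FiniteColength (partialIdeal x d) := by
  obtain ⟨N, hN⟩ := h.stable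
  exact (h.finite (N + 1)).mono ((hN N le_rfl).trans Ideal.mul_le_left)

theorem finiteColength_mul (j : ℕ) : FiniteColength (partialIdeal x d * F j) := by
  obtain ⟨N, hN⟩ := h.stable
  refine (h.finite (max N j + 1)).mono ((hN _ (le_max_left N j)).trans ?_)
  exact Ideal.mul_mono_right (h.anti (le_max_right N j))

/-- For large n superficiality gives (F_{n+1} + L_k) : x_k = F_n + L_k, so `colength_colon` turns
reduction modulo x_k into a first difference. -/
theorem colength_family {k : ℕ} (hk : k < d) : ∀ᶠ n in Filter.atTop,
    (colength (F (n + 1) ⊔ partialIdeal x (k + 1)) : ℤ) =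
      colength (F (n + 1) ⊔ partialIdeal x k) - colength (F n ⊔ partialIdeal x k) := by
  obtain ⟨N, hN⟩ := h.superficial k hk
  filter_upwards [Filter.eventually_ge_atTop N] with n hn
  have := colength_colon (I := F (n + 1) ⊔ partialIdeal x k) (Q := F n ⊔ partialIdeal x k) (x k)
    ((h.finite _).mono le_sup_left) (fun r => ⟨h.mul_mem_sup hk, hN n hn r⟩)
  rw [sup_assoc, ← partialIdeal_succ] at this
  omega

end IsSuperficialFiltration

end Filtration

/-! ### Bounds for the first Hilbert coefficient -/

section Numerics

theorem finsum_le_and_eq_iff {f g : ℕ → ℤ} (hle : ∀ j, f j ≤ g j)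
    (hf : ∀ᶠ j in Filter.atTop, f j = 0) (hg : ∀ᶠ j in Filter.atTop, g j = 0) :
    ∑ᶠ j, f j ≤ ∑ᶠ j, g j ∧ (∑ᶠ j, f j = ∑ᶠ j, g j ↔ ∀ j, f j = g j) := by
  obtain ⟨N, hN⟩ := Filter.eventually_atTop.1 (hf.and hg)
  have h1 : ∑ᶠ j, f j = ∑ j ∈ Finset.range N, f j := by
    refine finsum_eq_sum_of_support_subset _ fun j hj => ?_
    by_contra hlt
    exact hj (hN j (by simpa using hlt)).1
  have h2 : ∑ᶠ j, g j = ∑ j ∈ Finset.range N, g j := by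
    refine finsum_eq_sum_of_support_subset _ fun j hj => ?_
    by_contra hlt
    exact hj (hN j (by simpa using hlt)).2
  rw [h1, h2]
  refine ⟨Finset.sum_le_sum fun j _ => hle j, ?_⟩
  rw [Finset.sum_eq_sum_iff_of_le fun j _ => hle j]
  refine ⟨fun h j => ?_, fun h j _ => h j⟩
  by_cases hj : j < N
  · exact h j (Finset.mem_range.2 hj)
  · rw [(hN j (not_lt.1 hj)).1, (hN j (not_lt.1 hj)).2]

variable {R : Type*} [CommRing R]

/-- The length of `F_{j+1} / (x₀, …, x_m) F_j` modulo `x₀, …, x_{m-1}`. -/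
noncomputable def sectionLength (F : ℕ → Ideal R) (x : ℕ → R) (m j : ℕ) : ℤ :=
  colength (partialIdeal x (m + 1) * F j ⊔ partialIdeal x m) -
    colength (F (j + 1) ⊔ partialIdeal x m)

namespace IsSuperficialFiltration

variable {F : ℕ → Ideal R} {x : ℕ → R} {m : ℕ} (h : IsSuperficialFiltration F x (m + 1))

include h

/-- Modulo L_m the ideal J is generated by the nonzerodivisor x_m, and multiplication by x_m embeds
R/F_j in R/JF_j with cokernel R/J. -/
theorem colength_mul_sup (j : ℕ) : colength (partialIdeal x (m + 1) * F j ⊔ partialIdeal x m) =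
    colength (partialIdeal x (m + 1)) + colength (F j ⊔ partialIdeal x m) := by
  have h1 : ∀ r, r ∈ F j ⊔ partialIdeal x m ↔
      x m * r ∈ partialIdeal x (m + 1) * F j ⊔ partialIdeal x m := fun r => by
    rw [mul_sup_eq, mem_span_mul_sup (h.regular m m.lt_succ_self)]
  rw [colength_colon (x m) ((h.finiteColength_mul j).mono le_sup_left) h1, sup_assoc,
    ← partialIdeal_succ, sup_eq_right.2 Ideal.mul_le_left]

/-- By `colength_mul_sup` the sum telescopes. -/
theorem sum_sectionLength (n : ℕ) : ∑ j ∈ Finset.range n, sectionLength F x m j =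
    n * colength (partialIdeal x (m + 1)) - colength (F n ⊔ partialIdeal x m) := by
  induction n with
  | zero => simp [h.zero, colength_top]
  | succ n ih =>
    rw [Finset.sum_range_succ, ih, sectionLength, h.colength_mul_sup]
    push_cast
    ring

theorem eventually_eq_mul :
    ∀ᶠ j in Filter.atTop, F (j + 1) = partialIdeal x (m + 1) * F j := by
  obtain ⟨N, hN⟩ := h.stable
  filter_upwards [Filter.eventually_ge_atTop N] with j hj
  exact le_antisymm (hN j hj) (h.mul_le j)

theorem eventually_sectionLength : ∀ᶠ j in Filter.atTop, sectionLength F x m j = 0 := by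
  filter_upwards [h.eventually_eq_mul] with j hj
  rw [sectionLength, ← hj, sub_self]

theorem eventually_colength_sup : ∀ᶠ n : ℕ in Filter.atTop,
    (colength (F n ⊔ partialIdeal x m) : ℤ) =
      n * colength (partialIdeal x (m + 1)) - ∑ᶠ j, sectionLength F x m j := by
  obtain ⟨N, hN⟩ := Filter.eventually_atTop.1 h.eventually_sectionLength
  filter_upwards [Filter.eventually_ge_atTop N] with n hn
  have h1 : ∑ᶠ j, sectionLength F x m j = ∑ j ∈ Finset.range n, sectionLength F x m j := by
    refine finsum_eq_sum_of_support_subset _ fun j hj => ?_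
    by_contra hlt
    exact hj (hN j (hn.trans (by simpa using hlt)))
  rw [h1, h.sum_sectionLength]
  ring

theorem sectionLength_le (j : ℕ) :
    sectionLength F x m j ≤ colength (partialIdeal x (m + 1) * F j) - colength (F (j + 1)) ∧
    (sectionLength F x m j = colength (partialIdeal x (m + 1) * F j) - colength (F (j + 1)) ↔
      F (j + 1) ⊓ (partialIdeal x (m + 1) * F j ⊔ partialIdeal x m) ≤
        partialIdeal x (m + 1) * F j) :=
  colength_sup_sub_le (h.finiteColength_mul j) (h.mul_le j)

/-- Equality in all degrees amounts to the Valabrega–Valla condition for x₀, …, x_{m-1}. This makes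
the initial form of x_{m-1} regular, and Sally's descent reaches the earlier ones. -/
theorem forall_sectionLength_eq_iff :
    (∀ j, sectionLength F x m j =
      colength (partialIdeal x (m + 1) * F j) - colength (F (j + 1))) ↔
    ∀ k < m, RegularInitialForm F x k := by
  simp only [(h.sectionLength_le _).2]
  constructor
  · intro hle
    -- By `hle` an element of L_m ∩ F_{j+2} lies in L_m F_{j+1} + x_m F_{j+1}. In its second part
    -- x_m f the factor f lies in L_m by regularity, hence in L_m F_j by induction, so x_m f ∈ L_m
    -- F_{j+1}.
    have key : ∀ j, partialIdeal x m ⊓ F (j + 1) ≤ partialIdeal x m * F j := by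
      intro j
      induction j with
      | zero => rw [h.zero, Ideal.mul_top]; exact inf_le_left
      | succ j ih =>
        rintro a ⟨haL, haF⟩
        have h1 := hle (j + 1) ⟨haF, Submodule.mem_sup_right haL⟩
        rw [partialIdeal_succ, Ideal.sup_mul] at h1
        obtain ⟨b, hb, c, hc, rfl⟩ := Submodule.mem_sup.1 h1
        refine Ideal.add_mem _ hb ?_
        obtain ⟨f, hf, rfl⟩ := Ideal.mem_span_singleton_mul.1 hc
        have h2 : x m * f ∈ partialIdeal x m := by
          have := Ideal.sub_mem _ haL (Ideal.mul_le_left hb)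
          simpa using this
        have h3 := ih ⟨h.regular m m.lt_succ_self f h2, hf⟩
        have h4 : x m * f ∈ partialIdeal x m * (partialIdeal x (m + 1) * F j) := by
          rw [mul_left_comm]
          exact Ideal.mul_mem_mul (mem_partialIdeal x m.lt_succ_self) h3
        exact Ideal.mul_mono_right (h.mul_le j) h4
    intro k hk
    obtain ⟨m, rfl⟩ : ∃ m', m = m' + 1 := ⟨m - 1, by omega⟩
    exact h.regularInitialForm_of_le (by omega)
      (h.regularInitialForm_of_inf_le (m := m) (by omega) key) (by omega)
  · rintro hC j a ⟨haF, ha⟩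
    obtain ⟨b, hb, l, hl, rfl⟩ := Submodule.mem_sup.1 ha
    refine Ideal.add_mem _ hb ?_
    refine Ideal.mul_mono_left (partialIdeal_mono x m.le_succ)
      (h.inf_le_of_regularInitialForm m.le_succ hC j ⟨hl, ?_⟩)
    have := Ideal.sub_mem _ haF (h.mul_le j hb)
    simpa using this

/-- Here one reduces further from L_m to J: F_{j+1}/JF_j modulo L_m maps onto (F_{j+1} + J)/J,
injectively iff x_m cancels in this degree. -/
theorem le_sectionLength (j : ℕ) :
    (colength (partialIdeal x (m + 1)) : ℤ) - colength (F (j + 1) ⊔ partialIdeal x (m + 1)) ≤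
      sectionLength F x m j ∧
    ((colength (partialIdeal x (m + 1)) : ℤ) - colength (F (j + 1) ⊔ partialIdeal x (m + 1)) =
      sectionLength F x m j ↔
      ∀ r, x m * r ∈ F (j + 1) ⊔ partialIdeal x m → r ∈ F j ⊔ partialIdeal x m) := by
  have hLL := partialIdeal_mono x m.le_succ
  have h1 := colength_sup_sub_le (L := partialIdeal x (m + 1))
    ((h.finiteColength_mul j).mono le_sup_left)
    (sup_le_sup_right (h.mul_le j) (partialIdeal x m))
  have h2 : partialIdeal x (m + 1) * F j ⊔ partialIdeal x m ⊔ partialIdeal x (m + 1) =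
      partialIdeal x (m + 1) := sup_eq_right.2 (sup_le Ideal.mul_le_left hLL)
  have h3 : F (j + 1) ⊔ partialIdeal x m ⊔ partialIdeal x (m + 1) =
      F (j + 1) ⊔ partialIdeal x (m + 1) := by rw [sup_assoc, sup_eq_right.2 hLL]
  rw [h2, h3] at h1
  refine ⟨h1.1, h1.2.trans ⟨fun hle r hr => ?_, ?_⟩⟩
  · rw [← mem_span_mul_sup (h.regular m m.lt_succ_self), ← mul_sup_eq]
    exact hle ⟨hr, Ideal.mul_mem_right _ _ (mem_partialIdeal x m.lt_succ_self)⟩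
  · rintro hC z ⟨hzF, hz⟩
    obtain ⟨r, hr⟩ := mem_partialIdeal_succ.1 hz
    have h4 : x m * r ∈ F (j + 1) ⊔ partialIdeal x m := by
      have := Ideal.sub_mem _ hzF (Ideal.mem_sup_right hr)
      simpa using this
    have h5 := hC r h4
    rw [← mem_span_mul_sup (h.regular m m.lt_succ_self), ← mul_sup_eq] at h5
    have := Ideal.add_mem _ h5 (Ideal.mem_sup_right hr)
    simpa using this

theorem forall_eq_sectionLength_iff :
    (∀ j, (colength (partialIdeal x (m + 1)) : ℤ) -
      colength (F (j + 1) ⊔ partialIdeal x (m + 1)) = sectionLength F x m j) ↔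
    ∀ k < m + 1, RegularInitialForm F x k := by
  simp only [(h.le_sectionLength _).2]
  constructor
  · intro hC k hk
    exact h.regularInitialForm_of_le m.lt_succ_self hC (Nat.lt_succ_iff.1 hk)
  · intro hC
    exact hC m m.lt_succ_self

/-- The upper bound for the first Hilbert coefficient. -/
theorem finsum_sectionLength_le :
    ∑ᶠ j, sectionLength F x m j ≤
      ∑ᶠ j, ((colength (partialIdeal x (m + 1) * F j) : ℤ) - colength (F (j + 1))) ∧
    (∑ᶠ j, sectionLength F x m j =
      ∑ᶠ j, ((colength (partialIdeal x (m + 1) * F j) : ℤ) - colength (F (j + 1))) ↔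
      ∀ k < m, RegularInitialForm F x k) := by
  rw [← h.forall_sectionLength_eq_iff]
  refine finsum_le_and_eq_iff (fun j => (h.sectionLength_le j).1) h.eventually_sectionLength ?_
  filter_upwards [h.eventually_eq_mul] with j hj
  rw [← hj, sub_self]

theorem eventually_le_partialIdeal :
    ∀ᶠ j in Filter.atTop, F (j + 1) ≤ partialIdeal x (m + 1) := by
  filter_upwards [h.eventually_eq_mul] with j hj
  rw [hj]
  exact Ideal.mul_le_left

/-- The lower bound for the first Hilbert coefficient. -/
theorem le_finsum_sectionLength :
    2 * (colength (partialIdeal x (m + 1)) : ℤ) - colength (F 1) -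
      colength (F 2 ⊔ partialIdeal x (m + 1)) ≤ ∑ᶠ j, sectionLength F x m j ∧
    (2 * (colength (partialIdeal x (m + 1)) : ℤ) - colength (F 1) -
      colength (F 2 ⊔ partialIdeal x (m + 1)) = ∑ᶠ j, sectionLength F x m j ↔
      (∀ k < m + 1, RegularInitialForm F x k) ∧
        ∀ n, 3 ≤ n → F n ⊔ partialIdeal x (m + 1) = partialIdeal x (m + 1)) := by
  set J := partialIdeal x (m + 1) with hJ
  set u : ℕ → ℤ := fun j => (colength J : ℤ) - colength (F (j + 1) ⊔ J) with hu
  -- The lower bounds `u` with all but the terms j = 0, 1 discarded; nothing is lost iff F_n ⊆ J for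
  -- n ≥ 3.
  set g : ℕ → ℤ := fun j => if j < 2 then u j else 0 with hg
  have hfin : FiniteColength J := h.finiteColength_partialIdeal
  have hu0 : ∀ j, 0 ≤ u j := fun j => by
    have := colength_le hfin (le_sup_right : J ≤ F (j + 1) ⊔ J)
    simp only [hu]
    omega
  have hue : ∀ᶠ j in Filter.atTop, u j = 0 := by
    filter_upwards [h.eventually_le_partialIdeal] with j hj
    simp only [hu]
    rw [sup_eq_right.2 hj, sub_self]
  have hge : ∀ᶠ j in Filter.atTop, g j = 0 := by
    filter_upwards [Filter.eventually_ge_atTop 2] with j hj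
    simp only [hg]
    rw [if_neg (by omega)]
  have hgu : ∀ j, g j ≤ u j := fun j => by
    simp only [hg]
    split_ifs with hj
    · exact le_rfl
    · exact hu0 j
  have hgsum : ∑ᶠ j, g j = 2 * (colength J : ℤ) - colength (F 1) - colength (F 2 ⊔ J) := by
    have h1 : ∑ᶠ j, g j = ∑ j ∈ Finset.range 2, g j := by
      refine finsum_eq_sum_of_support_subset _ fun j hj => ?_
      by_contra hlt
      refine hj ?_
      simp only [hg]
      rw [if_neg (by simpa using hlt)]
    rw [h1, Finset.sum_range_succ, Finset.sum_range_one]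
    simp only [hg, hu, zero_add, one_add_one_eq_two, Nat.zero_lt_two, if_true, Nat.one_lt_two]
    rw [sup_eq_left.2 h.partialIdeal_le]
    ring
  rw [← hgsum, ← h.forall_eq_sectionLength_iff]
  have h1 := finsum_le_and_eq_iff hgu hge hue
  have h2 := finsum_le_and_eq_iff (fun j => (h.le_sectionLength j).1) hue
    h.eventually_sectionLength
  have h3 : (∀ j, g j = u j) ↔ ∀ n, 3 ≤ n → F n ⊔ J = J := by
    constructor
    · intro hj n hn
      have h4 := hj (n - 1)
      simp only [hg, hu] at h4
      rw [if_neg (by omega), Nat.sub_add_cancel (by omega)] at h4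
      exact eq_of_colength_eq hfin le_sup_right (by omega)
    · intro hn j
      simp only [hg]
      split_ifs with hj
      · rfl
      · simp only [hu]
        rw [hn (j + 1) (by omega), sub_self]
  refine ⟨h1.1.trans h2.1, ?_⟩
  rw [← h3, and_comm, ← h1.2]
  change _ ↔ _ ∧ ∀ j, u j = _
  rw [← h2.2]
  constructor
  · intro he
    have := h1.1
    have := h2.1
    exact ⟨by linarith, by linarith⟩
  · rintro ⟨ha, hb⟩
    exact ha.trans hb

/-- For a regular sequence inside K, J/JK is free of rank m + 1 over R/K. The generators are peeled
off one at a time, each contributing a copy of R/K because (JK + L_k) : x_k = K. -/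
theorem colength_mul_of_le {K : Ideal R} (hK : partialIdeal x (m + 1) ≤ K)
    (hfin : FiniteColength (partialIdeal x (m + 1) * K)) :
    colength (partialIdeal x (m + 1) * K) =
      (m + 1) * colength K + colength (partialIdeal x (m + 1)) := by
  set J := partialIdeal x (m + 1) with hJ
  -- The generators of index above k are eliminated from the top: if x_n κ is the last contribution,
  -- regularity puts κ in L_n, and x_n ∈ K then gives x_n κ ∈ L_n K.
  have hdesc : ∀ k ≤ m, ∀ i ≤ m - k, ∀ a ∈ partialIdeal x (k + 1),
      a ∈ partialIdeal x k ⊔ J * K →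
      a ∈ partialIdeal x k ⊔ partialIdeal x (m + 1 - i) * K := by
    intro k hk i
    induction i with
    | zero => intro _ a _ ha; exact ha
    | succ i ih =>
      intro hi a hak ha
      have h1 := ih (by omega) a hak ha
      have h2 : m + 1 - i = m + 1 - (i + 1) + 1 := by omega
      set n := m + 1 - (i + 1) with hn
      rw [h2, partialIdeal_succ, Ideal.sup_mul, ← sup_assoc] at h1
      obtain ⟨b, hb, c, hc, rfl⟩ := Submodule.mem_sup.1 h1
      refine Ideal.add_mem _ hb ?_
      obtain ⟨κ, hκ, rfl⟩ := Ideal.mem_span_singleton_mul.1 hc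
      have hbn : b ∈ partialIdeal x n :=
        (sup_le (partialIdeal_mono x (by omega)) Ideal.mul_le_left :
          partialIdeal x k ⊔ partialIdeal x n * K ≤ partialIdeal x n) hb
      have h3 : x n * κ ∈ partialIdeal x n := by
        have := Ideal.sub_mem _ (partialIdeal_mono x (by omega : k + 1 ≤ n) hak) hbn
        simpa using this
      have h4 := h.regular n (by omega) κ h3
      refine Ideal.mem_sup_right ?_
      rw [mul_comm (x n) κ]
      exact Ideal.mul_mem_mul h4 (hK (mem_partialIdeal x (by omega)))
  have hstep : ∀ k ≤ m, colength (J * K ⊔ partialIdeal x k) =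
      colength (J * K ⊔ partialIdeal x (k + 1)) + colength K := by
    intro k hk
    rw [colength_colon (I := J * K ⊔ partialIdeal x k) (Q := K) (x k) (hfin.mono le_sup_left),
      sup_assoc, ← partialIdeal_succ]
    intro r
    constructor
    · intro hr
      exact Ideal.mem_sup_left (Ideal.mul_mem_mul (mem_partialIdeal x (by omega)) hr)
    · intro hr
      have h1 := hdesc k hk (m - k) le_rfl (x k * r)
        (Ideal.mul_mem_right _ _ (mem_partialIdeal x k.lt_succ_self)) (by rwa [sup_comm])
      rw [show m + 1 - (m - k) = k + 1 by omega, sup_comm, mul_sup_eq,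
        mem_span_mul_sup (h.regular k (by omega))] at h1
      exact (sup_le le_rfl ((partialIdeal_mono x (by omega)).trans hK)) h1
  have hsum : ∀ k ≤ m + 1, colength (J * K) =
      k * colength K + colength (J * K ⊔ partialIdeal x k) := by
    intro k
    induction k with
    | zero => intro _; simp [partialIdeal_zero]
    | succ k ih =>
      intro hk
      rw [ih (by omega), hstep k (by omega)]
      ring
  rw [hsum (m + 1) le_rfl, sup_eq_right.2 Ideal.mul_le_left]

end IsSuperficialFiltration

end Numerics

/-! ### Regular sequences, support dimension and associated primes -/

section CommutativeAlgebra

universe u v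

open scoped Pointwise

open RingTheory.Sequence CategoryTheory CategoryTheory.Abelian

theorem smul_top_quotSMulTop_ne_top {R : Type*} [CommRing R] {M : Type*} [AddCommGroup M]
    [Module R M] {I : Ideal R} {r : R} (hr : r ∈ I) (hI : I • (⊤ : Submodule R M) ≠ ⊤) :
    I • (⊤ : Submodule R (QuotSMulTop r M)) ≠ ⊤ := by
  intro eq
  refine absurd (congrArg (Submodule.comap (Submodule.mkQ _)) eq) ?_
  simpa [Submodule.comap_smul_top_of_surjective I _ (Submodule.mkQ_surjective _),
    Submodule.smul_mono_left ((Ideal.span_singleton_le_iff_mem I).mpr hr),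
    ← Submodule.ideal_span_singleton_smul] using hI

/-- Dividing by a regular element of `𝔞` lowers the maximal length of regular sequences in `𝔞` by
at most one. -/
theorem exists_isRegular_quotSMulTop {A : Type u} [CommRing A] [IsNoetherianRing A] {𝔞 : Ideal A}
    {M : Type u} [AddCommGroup M] [Module A M] [Module.Finite A M]
    (hM : 𝔞 • (⊤ : Submodule A M) ≠ ⊤) {rs : List A} {n : ℕ} (hlen : rs.length = n + 1)
    (hmem : ∀ r ∈ rs, r ∈ 𝔞) (hrs : IsRegular M rs) {y : A} (hy : y ∈ 𝔞)
    (hyM : IsSMulRegular M y) :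
    ∃ rs' : List A, rs'.length = n ∧ (∀ r ∈ rs', r ∈ 𝔞) ∧ IsRegular (QuotSMulTop y M) rs' := by
  have hsupp : Module.support A (ModuleCat.of A (A ⧸ 𝔞)) = PrimeSpectrum.zeroLocus 𝔞 := by
    rw [Module.support_eq_zeroLocus]
    exact congrArg (fun I : Ideal A => PrimeSpectrum.zeroLocus (I : Set A))
      Ideal.annihilator_quotient
  -- Rees's characterization: the sequence makes Ext^i(A/𝔞, M) vanish for i ≤ n. The long exact
  -- sequence of multiplication by `y` passes the vanishing to M/yM for i < n, and this returns a
  -- regular sequence of length n.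
  have h1 := ModuleCat.subsingleton_ext_of_exists_isRegular 𝔞 (ModuleCat.of A (A ⧸ 𝔞)) hsupp.subset
    (ModuleCat.of A M) hM.lt_top rs hmem hrs
  rw [hlen] at h1
  refine ModuleCat.exists_isRegular_of_exists_subsingleton_ext 𝔞 n
    (ModuleCat.of A (QuotSMulTop y M)) (smul_top_quotSMulTop_ne_top hy hM).lt_top
    (ModuleCat.of A (A ⧸ 𝔞)) hsupp fun i hi => ?_
  have zero1 := AddCommGrpCat.isZero_of_iff_subsingleton.mpr (h1 i (by omega))
  have zero2 := AddCommGrpCat.isZero_of_iff_subsingleton.mpr (h1 (i + 1) (by omega))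
  have hyM' : IsSMulRegular (ModuleCat.of A M) y := hyM
  exact AddCommGrpCat.subsingleton_of_isZero <| ShortComplex.Exact.isZero_of_both_zeros
    ((Ext.covariant_sequence_exact₃' _ hyM'.smulShortComplex_shortExact) i (i + 1) rfl)
    (zero1.eq_zero_of_src _) (zero2.eq_zero_of_tgt _)

theorem supportDim_quotSMulTop_succ_le {A : Type*} [CommRing A] {M : Type*}
    [AddCommGroup M] [Module A M] [Module.Finite A M] {y : A} (hy : IsSMulRegular M y) :
    Module.supportDim A (QuotSMulTop y M) + 1 ≤ Module.supportDim A M :=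
  Module.supportDim_quotSMulTop_succ_le_of_notMem_minimalPrimes
    fun _ hp => hy.notMem_of_mem_minimalPrimes hp

theorem length_le_supportDim {A : Type*} [CommRing A] {M : Type*}
    [AddCommGroup M] [Module A M] [Module.Finite A M] {rs : List A} (h : IsRegular M rs) :
    (rs.length : WithBot ℕ∞) ≤ Module.supportDim A M := by
  induction rs generalizing M with
  | nil =>
    have := h.nontrivial
    have h1 := Module.supportDim_ne_bot_of_nontrivial A M
    rw [List.length_nil, Nat.cast_zero]
    obtain ⟨n, hn⟩ := WithBot.ne_bot_iff_exists.1 h1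
    rw [← hn]
    exact WithBot.coe_le_coe.2 zero_le
  | cons a rs ih =>
    rw [isRegular_cons_iff] at h
    refine le_trans ?_ (supportDim_quotSMulTop_succ_le h.1)
    rw [List.length_cons, Nat.cast_succ]
    exact add_le_add (ih h.2) le_rfl

/-- The dimension of a module does not increase under a change of rings for which it stays
finitely generated. -/
theorem supportDim_le_of_finite (P : Type*) {A M : Type*} [CommRing P] [CommRing A] [Algebra P A]
    [AddCommGroup M] [Module P M] [Module A M] [IsScalarTower P A M] [Module.Finite P M] :
    Module.supportDim A M ≤ Module.supportDim P M := by
  have : Module.Finite A M := Module.Finite.of_restrictScalars_finite P A M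
  have hmem : ∀ p : Module.support A M,
      p.1.comap (algebraMap P A) ∈ Module.support P M := by
    intro p
    have hp := (Set.ext_iff.1 (Module.support_eq_zeroLocus (R := A) (M := M)) p.1).1 p.2
    rw [Module.support_eq_zeroLocus]
    intro a ha
    refine hp ?_
    rw [SetLike.mem_coe, Module.mem_annihilator] at ha ⊢
    intro m
    rw [algebraMap_smul, ha]
  refine Order.krullDim_le_of_strictMono (fun p => ⟨p.1.comap (algebraMap P A), hmem p⟩) ?_
  intro p q hpq
  have hlt : p.1.asIdeal < q.1.asIdeal := hpq
  obtain ⟨hle, a, haq, hap⟩ := SetLike.lt_iff_le_and_exists.1 hlt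
  -- Incomparability: by Cayley–Hamilton a ∈ q \ p satisfies a monic equation over `P` modulo the
  -- annihilator of M, so p and q cannot have the same contraction.
  obtain ⟨f, hf, hfa⟩ := LinearMap.exists_monic_and_aeval_eq_zero P (Algebra.lsmul P P M a)
  have hann : Polynomial.aeval a f ∈ Module.annihilator A M := by
    rw [Module.mem_annihilator]
    intro m
    rw [Polynomial.aeval_algHom_apply] at hfa
    exact LinearMap.congr_fun hfa m
  have hp := (Set.ext_iff.1 (Module.support_eq_zeroLocus (R := A) (M := M)) p.1).1 p.2
  exact Ideal.comap_lt_comap_of_root_mem_sdiff (I := p.1.asIdeal) hle ⟨haq, hap⟩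
    (hf.map _).ne_zero (hp hann)

/-- An associated prime of a module of depth `n` over a local ring has dimension at least `n`. -/
theorem length_le_ringKrullDim_quotient {R : Type*} [CommRing R] [IsNoetherianRing R]
    [IsLocalRing R] {M : Type*} [AddCommGroup M] [Module R M] [Module.Finite R M] {rs : List R}
    (hmem : ∀ r ∈ rs, r ∈ IsLocalRing.maximalIdeal R) (h : IsWeaklyRegular M rs) {p : Ideal R}
    (hp : IsAssociatedPrime p M) : (rs.length : WithBot ℕ∞) ≤ ringKrullDim (R ⧸ p) := by
  induction rs generalizing M p with
  | nil =>
    have := hp.isPrime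
    simpa using ringKrullDim_nonneg_of_nontrivial (R := R ⧸ p)
  | cons a rs ih =>
    rw [isWeaklyRegular_cons_iff] at h
    have hprime := hp.isPrime
    obtain ⟨-, z, hz⟩ := (isAssociatedPrime_iff).1 hp
    have hz' : ∀ r, r ∈ p ↔ r • z = 0 := fun r => by
      rw [hz, Submodule.mem_colon_singleton, Submodule.mem_bot]
    have hz0 : z ≠ 0 := fun h0 => hprime.ne_top
      ((Ideal.eq_top_iff_one p).2 ((hz' 1).2 (by rw [h0, smul_zero])))
    have hap : a ∉ p := fun ha => hz0 (h.1 (by simpa using (hz' a).1 ha))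
    -- Otherwise the submodule T of elements killed by p would satisfy T = aT, since a is regular,
    -- and would vanish by Nakayama. The class of z' in M/aM then yields an associated prime q
    -- containing p and a, and induction applies to q.
    have hN : ∃ z' : M, (∀ r ∈ p, r • z' = 0) ∧ z' ∉ a • (⊤ : Submodule R M) := by
      by_contra hcon
      push Not at hcon
      have hN0 : (Submodule.torsionBySet R M p : Submodule R M) = ⊥ := by
        refine Submodule.eq_bot_of_le_smul_of_le_jacobson_bot (IsLocalRing.maximalIdeal R) _
          (IsNoetherian.noetherian _) ?_ (IsLocalRing.maximalIdeal_le_jacobson _)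
        intro w hw
        obtain ⟨w', -, rfl⟩ := hcon w fun r hr => by
          simpa using (Submodule.mem_torsionBySet_iff _ _).1 hw ⟨r, hr⟩
        refine Submodule.smul_mem_smul (hmem a (by simp)) ?_
        rw [Submodule.mem_torsionBySet_iff]
        intro r
        have h1 := (Submodule.mem_torsionBySet_iff _ _).1 hw r
        refine h.1 ?_
        change a • (r : R) • w' = a • 0
        rw [smul_zero, smul_comm]
        exact h1
      refine hz0 ?_
      have : z ∈ (Submodule.torsionBySet R M p : Submodule R M) :=
        (Submodule.mem_torsionBySet_iff _ _).2 fun r => (hz' r).1 r.2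
      rwa [hN0, Submodule.mem_bot] at this
    obtain ⟨z', hz'p, hz'a⟩ := hN
    obtain ⟨q, hq, hqle⟩ := exists_le_isAssociatedPrime_of_isNoetherianRing R
      (Submodule.Quotient.mk z' : QuotSMulTop a M)
      (fun h0 => hz'a ((Submodule.Quotient.mk_eq_zero _).1 h0))
    have hpq : p ≤ q := fun r hr => hqle (by
      rw [Submodule.mem_colon_singleton, Submodule.mem_bot, ← Submodule.Quotient.mk_smul,
        hz'p r hr, Submodule.Quotient.mk_zero])
    have haq : a ∈ q := hqle (by
      rw [Submodule.mem_colon_singleton, Submodule.mem_bot, ← Submodule.Quotient.mk_smul,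
        Submodule.Quotient.mk_eq_zero]
      exact Submodule.smul_mem_pointwise_smul _ _ _ trivial)
    have h1 := ih (M := QuotSMulTop a M) (fun r hr => hmem r (by simp [hr])) h.2 hq
    have h2 := ringKrullDim_succ_le_of_surjective (Ideal.Quotient.factor hpq)
      (Ideal.Quotient.factor_surjective hpq) (r := Ideal.Quotient.mk p a)
      (mem_nonZeroDivisors_of_ne_zero (fun h0 => hap (Ideal.Quotient.eq_zero_iff_mem.1 h0)))
      (by rw [Ideal.Quotient.factor_mk]; exact Ideal.Quotient.eq_zero_iff_mem.2 haq)
    refine le_trans ?_ h2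
    rw [List.length_cons, Nat.cast_succ]
    exact add_le_add h1 le_rfl

/-- Dividing `M / N` by `r` gives `M / (N + r M)`. -/
noncomputable def quotSMulTopQuotientEquiv {A M : Type*} [CommRing A] [AddCommGroup M] [Module A M]
    (N : Submodule A M) (r : A) {N' : Submodule A M}
    (hN' : N' = N ⊔ Ideal.span {r} • (⊤ : Submodule A M)) :
    QuotSMulTop r (M ⧸ N) ≃ₗ[A] M ⧸ N' :=
  Submodule.quotEquivOfEq _ _ (by
    rw [← Submodule.ideal_span_singleton_smul, ← Submodule.range_mkQ N, ← Submodule.map_top,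
      ← Submodule.map_smul'', ← sup_eq_right.2 (le_sup_left.trans_eq hN'.symm : N ≤ N'), hN', ← sup_assoc, sup_idem,
      Submodule.map_sup, Submodule.mkQ_map_self, bot_sup_eq]) ≪≫ₗ
  Submodule.quotientQuotientEquivQuotient N N' (le_sup_left.trans_eq hN'.symm)

end CommutativeAlgebra

/-! ### Depth of the associated graded module and initial forms -/

section AssociatedGraded

universe u

open RingTheory.Sequence PolynomialModule
open scoped Pointwise

section SubQuotient

variable {A : Type*} [CommRing A] {M : Type*} [AddCommGroup M] [Module A M]

/-- The submodule `T + r S`. -/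
def supSMul (S T : Submodule A M) (r : A) : Submodule A M := T ⊔ Ideal.span {r} • S

theorem mem_supSMul {S T : Submodule A M} {r : A} {p : M} :
    p ∈ supSMul S T r ↔ ∃ t ∈ T, ∃ q ∈ S, t + r • q = p := by
  rw [supSMul, Submodule.mem_sup, Submodule.ideal_span_singleton_smul]
  constructor
  · rintro ⟨t, ht, _, ⟨q, hq, rfl⟩, h⟩
    exact ⟨t, ht, q, hq, h⟩
  · rintro ⟨t, ht, q, hq, h⟩
    exact ⟨t, ht, r • q, Submodule.smul_mem_pointwise_smul _ _ _ hq, h⟩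

/-- The class in `S / T` of an element of `S`. -/
def subQuotientMk (S T : Submodule A M) (p : M) (hp : p ∈ S) : SubQuotient S T :=
  (T.submoduleOf S).mkQ ⟨p, hp⟩

theorem exists_subQuotientMk {S T : Submodule A M} (z : SubQuotient S T) :
    ∃ p hp, subQuotientMk S T p hp = z := by
  obtain ⟨⟨p, hp⟩, rfl⟩ := (T.submoduleOf S).mkQ_surjective z
  exact ⟨p, hp, rfl⟩

theorem subQuotientMk_eq_zero {S T : Submodule A M} {p : M} {hp : p ∈ S} :
    subQuotientMk S T p hp = 0 ↔ p ∈ T :=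
  Submodule.Quotient.mk_eq_zero (T.submoduleOf S)

theorem subQuotientMk_add {S T : Submodule A M} {p q : M} (hp : p ∈ S) (hq : q ∈ S) :
    subQuotientMk S T (p + q) (S.add_mem hp hq) = subQuotientMk S T p hp + subQuotientMk S T q hq :=
  rfl

theorem subQuotientMk_smul {S T : Submodule A M} {p : M} (hp : p ∈ S) (a : A) :
    subQuotientMk S T (a • p) (S.smul_mem a hp) = a • subQuotientMk S T p hp :=
  rfl

theorem isSMulRegular_subQuotient_iff {S T : Submodule A M} {r : A} :
    IsSMulRegular (SubQuotient S T) r ↔ ∀ p ∈ S, r • p ∈ T → p ∈ T :=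
  (isSMulRegular_quotient_iff_mem_of_smul_mem (T.submoduleOf S) r).trans
    ⟨fun h p hp hr => h ⟨p, hp⟩ hr, fun h p hr => h p.1 p.2 hr⟩

/-- `(S / T) / r (S / T)` is `S / (T + r S)`. -/
noncomputable def quotSMulTopSubQuotientEquiv {S T : Submodule A M} (hT : T ≤ S) (r : A) :
    QuotSMulTop r (SubQuotient S T) ≃ₗ[A] SubQuotient S (supSMul S T r) :=
  quotSMulTopQuotientEquiv (T.submoduleOf S) r (by
    ext p
    rw [Submodule.mem_sup, Submodule.ideal_span_singleton_smul]
    change p.1 ∈ supSMul S T r ↔ _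
    rw [mem_supSMul]
    constructor
    · rintro ⟨t, ht, q, hq, h⟩
      exact ⟨⟨t, hT ht⟩, ht, r • ⟨q, hq⟩, Submodule.smul_mem_pointwise_smul _ _ _ trivial,
        Subtype.ext h⟩
    · rintro ⟨t, ht, _, ⟨q, -, rfl⟩, rfl⟩
      exact ⟨t.1, ht, q.1, q.2, rfl⟩)

theorem le_smul_sup_of_smul_top_eq_top {S T : Submodule A M} {𝔞 : Ideal A}
    (h : 𝔞 • (⊤ : Submodule A (SubQuotient S T)) = ⊤) : S ≤ 𝔞 • S ⊔ T := by
  have h' : 𝔞 • (⊤ : Submodule A (S ⧸ T.submoduleOf S)) = ⊤ := h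
  have h4 := congrArg (Submodule.comap (T.submoduleOf S).mkQ) h'
  rw [Submodule.comap_top, ← Submodule.range_mkQ, ← Submodule.map_top, ← Submodule.map_smul'',
    Submodule.comap_map_mkQ] at h4
  intro p hp
  have h5 : (⟨p, hp⟩ : S) ∈ T.submoduleOf S ⊔ 𝔞 • ⊤ := by rw [h4]; trivial
  obtain ⟨t, ht, q, hq, htq⟩ := Submodule.mem_sup.1 h5
  have h6 : q.1 ∈ 𝔞 • S := by
    have := Submodule.mem_map_of_mem (f := S.subtype) hq
    rwa [Submodule.map_smul'', Submodule.map_top, Submodule.range_subtype] at this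
  rw [sup_comm, show p = t.1 + q.1 from (congrArg Subtype.val htq).symm]
  exact Submodule.add_mem_sup ht h6

theorem finite_subQuotient {S : Submodule A M} (hS : S.FG) (T : Submodule A M) :
    Module.Finite A (SubQuotient S T) := by
  have : Module.Finite A S := Module.Finite.iff_fg.2 hS
  exact inferInstanceAs (Module.Finite A (S ⧸ T.submoduleOf S))

end SubQuotient

variable {R : Type u} [CommRing R] {K : Ideal R} (Φ : K.Filtration R) {x : ℕ → R} {d : ℕ}

/-- The element `x_k t` of the Rees algebra of `K`. -/
noncomputable def initialForm (hxK : ∀ k, x k ∈ K) (k : ℕ) : reesAlgebra K :=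
  ⟨Polynomial.monomial 1 (x k), reesAlgebra.monomial_mem.2 (by simpa using hxK k)⟩

/-- The submodule `⨁ Φ_{n+1} tⁿ + (x₀ t, …, x_{k-1} t) ⨁ Φ_n tⁿ` of `⨁ Φ_n tⁿ`. -/
noncomputable def initialSubmodule (hxK : ∀ k, x k ∈ K) :
    ℕ → Submodule (reesAlgebra K) (PolynomialModule R R)
  | 0 => (shift Φ).submodule
  | k + 1 => supSMul Φ.submodule (initialSubmodule hxK k) (initialForm hxK k)

variable (hxK : ∀ k, x k ∈ K)

theorem single_mem {n : ℕ} {f : R} (hf : f ∈ Φ.N n) : single R n f ∈ Φ.submodule := fun i => by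
  rw [coeff_single, Finsupp.single_apply]
  split_ifs with hi
  · exact hi ▸ hf
  · exact Submodule.zero_mem _

theorem coeff_reesAlgebra_smul (a : reesAlgebra K) (p : PolynomialModule R R) (n : ℕ) :
    (a • p).coeff n =
      ∑ i ∈ Finset.HasAntidiagonal.antidiagonal n, a.1.coeff i.1 * p.coeff i.2 := by
  have : a • p = a.1 • p := rfl
  rw [this, PolynomialModule.smul_apply]
  rfl

theorem coeff_initialForm_smul (k : ℕ) (p : PolynomialModule R R) (n : ℕ) :
    (initialForm hxK k • p).coeff n = if 1 ≤ n then x k * p.coeff (n - 1) else 0 := by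
  have : initialForm hxK k • p = Polynomial.monomial 1 (x k) • p := rfl
  rw [this, monomial_smul_apply]
  rfl

variable {Φ}

theorem coeff_mem_of_mem_initialSubmodule {k : ℕ} {p : PolynomialModule R R}
    (hp : p ∈ initialSubmodule Φ hxK k) (n : ℕ) :
    p.coeff n ∈ Φ.N (n + 1) ⊔ partialIdeal x k := by
  induction k generalizing p n with
  | zero => exact Submodule.mem_sup_left (hp n)
  | succ k ih =>
    obtain ⟨a, ha, q, -, rfl⟩ := mem_supSMul.1 hp
    rw [coeff_add, Finsupp.add_apply, coeff_initialForm_smul]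
    refine Ideal.add_mem _ (sup_le_sup_left (partialIdeal_mono x k.le_succ) _ (ih ha n)) ?_
    split_ifs
    · exact Ideal.mem_sup_right (Ideal.mul_mem_right _ _ (mem_partialIdeal x k.lt_succ_self))
    · exact Ideal.zero_mem _

theorem initialSubmodule_mono : Monotone (initialSubmodule Φ hxK) :=
  monotone_nat_of_le_succ fun _ => le_sup_left

theorem initialSubmodule_le (k : ℕ) : initialSubmodule Φ hxK k ≤ Φ.submodule := by
  induction k with
  | zero => exact fun p hp n => Φ.mono n (hp n)
  | succ k ih =>
    intro p hp
    obtain ⟨a, ha, q, hq, rfl⟩ := mem_supSMul.1 hp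
    exact Submodule.add_mem _ (ih ha) (Submodule.smul_mem _ _ hq)

theorem single_mem_of_mem_succ {n : ℕ} {f : R} (hf : f ∈ Φ.N (n + 1)) (k : ℕ) :
    single R n f ∈ initialSubmodule Φ hxK k :=
  initialSubmodule_mono hxK k.zero_le (single_mem (shift Φ) hf)

theorem single_mem_of_mem_mul {n k : ℕ} {f : R} (hf : f ∈ partialIdeal x k * Φ.N n) :
    single R (n + 1) f ∈ initialSubmodule Φ hxK k := by
  induction k generalizing f with
  | zero =>
    rw [partialIdeal_zero, Submodule.bot_mul, Submodule.mem_bot] at hf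
    exact single_mem_of_mem_succ hxK (by rw [hf]; exact Submodule.zero_mem _) 0
  | succ k ih =>
    rw [partialIdeal_succ, Ideal.sup_mul] at hf
    obtain ⟨a, ha, b, hb, rfl⟩ := Submodule.mem_sup.1 hf
    obtain ⟨c, hc, rfl⟩ := Ideal.mem_span_singleton_mul.1 hb
    refine mem_supSMul.2 ⟨_, ih ha, single R n c, single_mem Φ hc, ?_⟩
    change _ + Polynomial.monomial 1 (x k) • single R n c = _
    rw [monomial_smul_single, add_comm 1 n, single_add, smul_eq_mul]

theorem mem_of_single_mem {W : Submodule (reesAlgebra K) (PolynomialModule R R)}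
    {p : PolynomialModule R R} (hp : ∀ n, single R n (p.coeff n) ∈ W) : p ∈ W := by
  have : p = ∑ n ∈ p.coeff.support, single R n (p.coeff n) := by
    refine PolynomialModule.ext ?_
    rw [coeff_sum]
    exact (Finsupp.sum_single p.coeff).symm
  rw [this]
  exact Submodule.sum_mem _ fun n _ => hp n

/-- Converse of `coeff_mem_of_mem_initialSubmodule`. The Valabrega–Valla inclusion is what allows
membership to be tested on coefficients. -/
theorem mem_initialSubmodule (h : IsSuperficialFiltration Φ.N x d) {k : ℕ} (hk : k ≤ d)
    (hC : ∀ i < k, RegularInitialForm Φ.N x i) {p : PolynomialModule R R}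
    (hpΦ : p ∈ Φ.submodule) (hp : ∀ n, p.coeff n ∈ Φ.N (n + 1) ⊔ partialIdeal x k) :
    p ∈ initialSubmodule Φ hxK k := by
  have hL : partialIdeal x k ≤ Φ.N 1 := (partialIdeal_mono x hk).trans h.partialIdeal_le
  refine mem_of_single_mem fun n => ?_
  rcases n with _ | n
  · exact single_mem_of_mem_succ hxK (sup_le le_rfl hL (hp 0)) k
  · obtain ⟨a, ha, l, hl, hal⟩ := Submodule.mem_sup.1 (hp (n + 1))
    have hlF : l ∈ Φ.N (n + 1) := by
      have := Submodule.sub_mem _ (hpΦ (n + 1)) (Φ.mono (n + 1) ha)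
      rw [← hal] at this
      simpa using this
    rw [← hal, single_add]
    exact Submodule.add_mem _ (single_mem_of_mem_succ hxK ha k)
      (single_mem_of_mem_mul hxK (h.inf_le_of_regularInitialForm hk hC n ⟨hl, hlF⟩))

theorem isSMulRegular_initialForm (h : IsSuperficialFiltration Φ.N x d) {k : ℕ} (hk : k < d)
    (hC : ∀ i ≤ k, RegularInitialForm Φ.N x i) :
    IsSMulRegular (SubQuotient Φ.submodule (initialSubmodule Φ hxK k)) (initialForm hxK k) := by
  rw [isSMulRegular_subQuotient_iff]
  intro p hpΦ hp
  refine mem_initialSubmodule hxK h hk.le (fun i hi => hC i hi.le) hpΦ fun n => ?_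
  have := coeff_mem_of_mem_initialSubmodule hxK hp (n + 1)
  rw [coeff_initialForm_smul, if_pos (by omega)] at this
  exact hC k le_rfl (n + 1) _ this

variable [IsLocalRing R]

theorem coeff_zero_mem_of_mem_reesMaximalIdeal {a : reesAlgebra K}
    (ha : a ∈ reesMaximalIdeal K) : a.1.coeff 0 ∈ IsLocalRing.maximalIdeal R := ha

theorem initialForm_mem (k : ℕ) : initialForm hxK k ∈ reesMaximalIdeal K := by
  change (Polynomial.monomial 1 (x k)).coeff 0 ∈ IsLocalRing.maximalIdeal R
  rw [Polynomial.coeff_monomial_of_ne _ (by omega)]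
  exact Ideal.zero_mem _

/-- The class of 1 in degree zero survives, since both submodules involved have constant
coefficients in the maximal ideal. -/
theorem smul_top_subQuotient_ne_top (hN : Φ.N 0 = ⊤)
    (hΦ : Φ.N 1 ≤ IsLocalRing.maximalIdeal R) (hK : K ≤ IsLocalRing.maximalIdeal R) (k : ℕ) :
    reesMaximalIdeal K • (⊤ : Submodule (reesAlgebra K)
      (SubQuotient Φ.submodule (initialSubmodule Φ hxK k))) ≠ ⊤ := by
  intro htop
  let Q : Submodule (reesAlgebra K) (PolynomialModule R R) :=
    { carrier := {p | p.coeff 0 ∈ IsLocalRing.maximalIdeal R}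
      add_mem' := fun ha hb => (IsLocalRing.maximalIdeal R).add_mem ha hb
      zero_mem' := (IsLocalRing.maximalIdeal R).zero_mem
      smul_mem' := fun a p hp => by
        change (a • p).coeff 0 ∈ IsLocalRing.maximalIdeal R
        rw [coeff_reesAlgebra_smul]
        simpa using (IsLocalRing.maximalIdeal R).mul_mem_left (a.1.coeff 0) hp }
  have h1 : initialSubmodule Φ hxK k ≤ Q := fun p hp => by
    change p.coeff 0 ∈ IsLocalRing.maximalIdeal R
    refine sup_le hΦ ?_ (coeff_mem_of_mem_initialSubmodule hxK hp 0)
    rw [partialIdeal, Ideal.span_le]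
    rintro _ ⟨j, -, rfl⟩
    exact hK (hxK j)
  have h2 : reesMaximalIdeal K • Φ.submodule ≤ Q := by
    rw [Submodule.smul_le]
    intro a ha p _
    change (a • p).coeff 0 ∈ IsLocalRing.maximalIdeal R
    rw [coeff_reesAlgebra_smul]
    simpa using Ideal.mul_mem_right (p.coeff 0) _ (coeff_zero_mem_of_mem_reesMaximalIdeal ha)
  have h5 : single R 0 (1 : R) ∈ Q :=
    (le_smul_sup_of_smul_top_eq_top htop).trans (sup_le h2 h1)
      (single_mem Φ (n := 0) (hN ▸ trivial))
  have h6 : (single R 0 (1 : R)).coeff 0 ∈ IsLocalRing.maximalIdeal R := h5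
  rw [coeff_single, Finsupp.single_eq_same] at h6
  exact (Ideal.ne_top_iff_one _).1 (IsLocalRing.maximalIdeal.isMaximal R).ne_top h6

/-- A regular element in the homogeneous maximal ideal forces the initial form of a superficial
element to be regular. -/
theorem regularInitialForm_of_isSMulRegular (h : IsSuperficialFiltration Φ.N x d)
    (hrad : IsLocalRing.maximalIdeal R ≤ K.radical) {k : ℕ} (hk : k < d)
    (hC : ∀ i < k, RegularInitialForm Φ.N x i) {a : reesAlgebra K}
    (ha : a ∈ reesMaximalIdeal K)
    (hreg : IsSMulRegular (SubQuotient Φ.submodule (initialSubmodule Φ hxK k)) a) :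
    RegularInitialForm Φ.N x k := by
  intro n r hr
  by_contra hrn
  -- The order of r modulo L_k. The class z of f in degree m is nonzero and is annihilated by the
  -- initial form of x_k; a power of `a` is shown to annihilate it too.
  obtain ⟨m, hmn, hm, hm'⟩ : ∃ m < n, r ∈ Φ.N m ⊔ partialIdeal x k ∧
      r ∉ Φ.N (m + 1) ⊔ partialIdeal x k := by
    by_contra hcon
    push Not at hcon
    have : ∀ m ≤ n, r ∈ Φ.N m ⊔ partialIdeal x k := by
      intro m
      induction m with
      | zero => intro _; rw [h.zero, top_sup_eq]; trivial
      | succ m ih => intro hm; exact hcon m hm (ih (by omega))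
    exact hrn (this n le_rfl)
  obtain ⟨f, hf, l, hl, rfl⟩ := Submodule.mem_sup.1 hm
  have hxf : x k * f ∈ Φ.N (m + 2) ⊔ partialIdeal x k := by
    have h1 := Submodule.sub_mem (Φ.N (n + 1) ⊔ partialIdeal x k) hr
      (Submodule.mem_sup_right (Ideal.mul_mem_left _ (x k) hl))
    rw [mul_add, add_sub_cancel_right] at h1
    exact sup_le_sup_right (h.anti (by omega)) _ h1
  have hf' : f ∉ Φ.N (m + 1) ⊔ partialIdeal x k := fun hcon =>
    hm' (Submodule.add_mem _ hcon (Submodule.mem_sup_right hl))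
  set z := single R m f with hz
  have hzΦ : z ∈ Φ.submodule := single_mem Φ hf
  have hzW : z ∉ initialSubmodule Φ hxK k := fun hcon => by
    have h1 := coeff_mem_of_mem_initialSubmodule hxK hcon m
    rw [hz, coeff_single, Finsupp.single_eq_same] at h1
    exact hf' h1
  set colon : Ideal (reesAlgebra K) := (initialSubmodule Φ hxK k).colon {z} with hcolon
  have hmem : ∀ b, b ∈ colon ↔ b • z ∈ initialSubmodule Φ hxK k := fun b => by
    rw [hcolon, Submodule.mem_colon_singleton]
  have hzc : ∀ (b : reesAlgebra K) (i : ℕ), (b • z).coeff i =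
      if m ≤ i then b.1.coeff (i - m) * f else 0 := fun b i => by
    change (b.1 • single R m f).coeff i = _
    rw [smul_single_apply]
    rfl
  set a₀ : reesAlgebra K := algebraMap R _ (a.1.coeff 0) with ha₀
  -- A power of the constant term lies in K, and K annihilates the graded module.
  have h0 : a₀ ∈ colon.radical := by
    obtain ⟨s, hs⟩ := hrad (coeff_zero_mem_of_mem_reesMaximalIdeal ha)
    refine ⟨s, (hmem _).2 (initialSubmodule_mono hxK k.zero_le fun i => ?_)⟩
    change (a₀ ^ s • z).coeff i ∈ Φ.N (i + 1)
    have h1 : (a₀ ^ s).1 = Polynomial.C (a.1.coeff 0 ^ s) := by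
      rw [ha₀, ← map_pow]
      rfl
    rw [hzc, h1, Polynomial.coeff_C]
    split_ifs with h2 h3
    · obtain rfl : i = m := by omega
      exact Φ.smul_le i (Submodule.smul_mem_smul hs hf)
    · rw [zero_mul]; exact Submodule.zero_mem _
    · exact Submodule.zero_mem _
  -- The N-th power lives in degrees at least N. There a coefficient b satisfies x_k b f ∈ F_{m+j+2}
  -- + L_k, and superficiality cancels x_k.
  have h1 : a - a₀ ∈ colon.radical := by
    obtain ⟨N, hN⟩ := h.superficial k hk
    refine ⟨N, (hmem _).2 (mem_initialSubmodule hxK h hk.le hC (Submodule.smul_mem _ _ hzΦ) fun i => ?_)⟩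
    rw [hzc]
    split_ifs with h2
    · obtain ⟨j, rfl⟩ := Nat.exists_eq_add_of_le h2
      rw [Nat.add_sub_cancel_left]
      by_cases hj : j < N
      · have h3 : (Polynomial.X : Polynomial R) ^ N ∣ ((a - a₀) ^ N).1 := by
          have : ((a - a₀) ^ N).1 = (a.1 - Polynomial.C (a.1.coeff 0)) ^ N := rfl
          rw [this]
          refine pow_dvd_pow_of_dvd ?_ N
          rw [Polynomial.X_dvd_iff]
          simp
        rw [Polynomial.X_pow_dvd_iff.1 h3 j hj, zero_mul]
        exact Submodule.zero_mem _
      · set b := ((a - a₀) ^ N).1.coeff j with hb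
        have hbK : b ∈ K ^ j := ((a - a₀) ^ N).2 j
        refine hN (m + j + 1) (by omega) (b * f) ?_
        obtain ⟨g, hg, l', hl', hgl⟩ := Submodule.mem_sup.1 hxf
        rw [mul_left_comm, ← hgl, mul_add]
        refine Submodule.add_mem_sup ?_ (Ideal.mul_mem_left _ _ hl')
        have h4 := Φ.pow_smul_le j (m + 2) (Submodule.smul_mem_smul hbK hg)
        rwa [show j + (m + 2) = m + j + 1 + 1 by omega] at h4
    · exact Submodule.zero_mem _
  have h2 : a ∈ colon.radical := by
    have := Ideal.add_mem _ h0 h1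
    simpa using this
  obtain ⟨s, hs⟩ := h2
  exact hzW (isSMulRegular_subQuotient_iff.1 (hreg.pow s) z hzΦ ((hmem _).1 hs))

/-- The induction builds the sequence of initial forms from its end: `n` counts the entries already
placed. -/
theorem exists_isRegular_initialQuotient (h : IsSuperficialFiltration Φ.N x d)
    (hΦ : Φ.N 1 ≤ IsLocalRing.maximalIdeal R) (hK : K ≤ IsLocalRing.maximalIdeal R) {m : ℕ}
    (hm : m ≤ d) (hC : ∀ k < m, RegularInitialForm Φ.N x k) {n : ℕ} (hn : n ≤ m) :
    ∃ rs : List (reesAlgebra K), rs.length = n ∧ (∀ r ∈ rs, r ∈ reesMaximalIdeal K) ∧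
      IsRegular (SubQuotient Φ.submodule (initialSubmodule Φ hxK (m - n))) rs := by
  induction n with
  | zero =>
    have : Nontrivial (SubQuotient Φ.submodule (initialSubmodule Φ hxK (m - 0))) := by
      by_contra hcon
      rw [not_nontrivial_iff_subsingleton] at hcon
      exact smul_top_subQuotient_ne_top hxK h.zero hΦ hK (m - 0) (Subsingleton.elim _ _)
    exact ⟨[], rfl, by simp, IsRegular.nil _ _⟩
  | succ n ih =>
    obtain ⟨rs, hlen, hmem, hrs⟩ := ih (by omega)
    refine ⟨initialForm hxK (m - (n + 1)) :: rs, by rw [List.length_cons, hlen], ?_, ?_⟩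
    · intro r hr
      rcases List.mem_cons.1 hr with rfl | hr
      · exact initialForm_mem hxK _
      · exact hmem r hr
    · rw [isRegular_cons_iff]
      refine ⟨isSMulRegular_initialForm hxK h (by omega) fun i hi => hC i (by omega), ?_⟩
      rw [show m - n = m - (n + 1) + 1 by omega] at hrs
      exact (LinearEquiv.isRegular_congr
        (quotSMulTopSubQuotientEquiv (initialSubmodule_le hxK _) _) rs).2 hrs

variable [IsNoetherianRing R]

omit [IsLocalRing R] in
theorem finite_initialQuotient (hst : Φ.Stable) (k : ℕ) :
    Module.Finite (reesAlgebra K) (SubQuotient Φ.submodule (initialSubmodule Φ hxK k)) :=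
  finite_subQuotient ((Φ.submodule_fg_iff_stable fun _ => IsNoetherian.noetherian _).2 hst) _

/-- An exchange argument: the head of the regular sequence forces the initial form of x_k to be
regular, and `exists_isRegular_quotSMulTop` then supplies a sequence one shorter on the quotient by
that form. -/
theorem regularInitialForm_of_isRegular (h : IsSuperficialFiltration Φ.N x d) (hst : Φ.Stable)
    (hΦ : Φ.N 1 ≤ IsLocalRing.maximalIdeal R) (hK : K ≤ IsLocalRing.maximalIdeal R)
    (hrad : IsLocalRing.maximalIdeal R ≤ K.radical) {m : ℕ} (hm : m ≤ d)
    {rs : List (reesAlgebra K)} (hlen : m ≤ rs.length) (hmem : ∀ r ∈ rs, r ∈ reesMaximalIdeal K)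
    (hrs : IsRegular (SubQuotient Φ.submodule (initialSubmodule Φ hxK 0)) rs) :
    ∀ k < m, RegularInitialForm Φ.N x k := by
  have key : ∀ k ≤ m, (∀ i < k, RegularInitialForm Φ.N x i) ∧
      ∃ rs' : List (reesAlgebra K), rs'.length = rs.length - k ∧ (∀ r ∈ rs', r ∈ reesMaximalIdeal K) ∧
        IsRegular (SubQuotient Φ.submodule (initialSubmodule Φ hxK k)) rs' := by
    intro k
    induction k with
    | zero => exact fun _ => ⟨by simp, rs, rfl, hmem, hrs⟩
    | succ k ih =>
      intro hk
      obtain ⟨hC, qs, hlen', hmem, hrs⟩ := ih (by omega)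
      have hfin := finite_initialQuotient hxK hst k
      have hCk : RegularInitialForm Φ.N x k := by
        cases qs with
        | nil => rw [List.length_nil] at hlen'; omega
        | cons a qs =>
          rw [isRegular_cons_iff] at hrs
          exact regularInitialForm_of_isSMulRegular hxK h hrad (by omega) hC (hmem a (by simp))
            hrs.1
      have hC' : ∀ i < k + 1, RegularInitialForm Φ.N x i := by
        intro i hi
        rcases Nat.lt_succ_iff_lt_or_eq.1 hi with hi | rfl
        · exact hC i hi
        · exact hCk
      refine ⟨hC', ?_⟩
      obtain ⟨rs', hlen', hmem', hrs'⟩ := exists_isRegular_quotSMulTop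
        (smul_top_subQuotient_ne_top hxK h.zero hΦ hK k)
        (by omega : qs.length = rs.length - (k + 1) + 1) hmem hrs (initialForm_mem hxK k)
        (isSMulRegular_initialForm hxK h (by omega) fun i hi => hC' i (by omega))
      exact ⟨rs', hlen', hmem',
        (LinearEquiv.isRegular_congr (quotSMulTopSubQuotientEquiv (initialSubmodule_le hxK _) _) rs').1 hrs'⟩
  exact (key m le_rfl).1

end AssociatedGraded

/-! ### Dimension of the associated graded module -/

section Dimension

universe u

open RingTheory.Sequence PolynomialModule

theorem isArtinian_of_supportDim_le_zero {A M : Type*} [CommRing A] [IsNoetherianRing A]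
    [AddCommGroup M] [Module A M] [Module.Finite A M] (h : Module.supportDim A M ≤ 0) :
    IsArtinian A M := by
  have h1 : IsArtinianRing (A ⧸ Module.annihilator A M) := by
    rw [isArtinianRing_iff_krullDimLE_zero, Ring.KrullDimLE, Order.krullDimLE_iff, ← ringKrullDim]
    rwa [Module.supportDim_eq_ringKrullDim_quotient_annihilator] at h
  have h2 : Module.IsTorsionBySet A M (Module.annihilator A M) :=
    Module.isTorsionBySet_annihilator A M
  let _ : Module (A ⧸ Module.annihilator A M) M := h2.module
  have : IsScalarTower A (A ⧸ Module.annihilator A M) M := h2.isScalarTower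
  have : Module.Finite (A ⧸ Module.annihilator A M) M :=
    Module.Finite.of_restrictScalars_finite A _ M
  exact (isArtinian_of_surjective_algebraMap (R := A ⧸ Module.annihilator A M)
    Ideal.Quotient.mk_surjective)

/-- A module generated by finitely many elements over the subalgebra generated by `d` elements has
dimension at most `d` more than that of the coefficients. -/
theorem supportDim_le_add {R A M : Type*} [CommRing R] [IsNoetherianRing R] [CommRing A]
    [Algebra R A] [AddCommGroup M] [Module A M] {I : Ideal R}
    (hI : ∀ a ∈ I, ∀ m : M, algebraMap R A a • m = 0) {d : ℕ} (y : Fin d → A) {s : Set M}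
    (hs : s.Finite) (hsM : ∀ N : AddSubgroup M, s ⊆ N →
      (∀ a : R, ∀ m ∈ N, algebraMap R A a • m ∈ N) → (∀ i, ∀ m ∈ N, y i • m ∈ N) → N = ⊤) :
    Module.supportDim A M ≤ ringKrullDim (R ⧸ I) + d := by
  -- M becomes finite over R[X₁, …, X_d] and is killed by I, so its dimension is at most that of
  -- (R/I)[X₁, …, X_d].
  let _ : Algebra (MvPolynomial (Fin d) R) A := (MvPolynomial.aeval y).toAlgebra
  let _ : Module (MvPolynomial (Fin d) R) M :=
    Module.compHom M (algebraMap (MvPolynomial (Fin d) R) A)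
  have : IsScalarTower (MvPolynomial (Fin d) R) A M := ⟨fun p a m => by
    rw [Algebra.smul_def, mul_smul]; rfl⟩
  have hC : ∀ (a : R) (m : M),
      (MvPolynomial.C a : MvPolynomial (Fin d) R) • m = algebraMap R A a • m := fun a m => by
    change (MvPolynomial.aeval y (MvPolynomial.C a)) • m = _
    rw [MvPolynomial.aeval_C]
  have hX : ∀ (i : Fin d) (m : M), (MvPolynomial.X i : MvPolynomial (Fin d) R) • m = y i • m :=
    fun i m => by
    change (MvPolynomial.aeval y (MvPolynomial.X i)) • m = _
    rw [MvPolynomial.aeval_X]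
  have hfin : Module.Finite (MvPolynomial (Fin d) R) M := by
    refine ⟨Submodule.fg_def.2 ⟨s, hs, ?_⟩⟩
    have := hsM (Submodule.span (MvPolynomial (Fin d) R) s).toAddSubgroup Submodule.subset_span
      (fun a m hm => by rw [← hC]; exact Submodule.smul_mem _ _ hm)
      (fun i m hm => by rw [← hX]; exact Submodule.smul_mem _ _ hm)
    exact Submodule.toAddSubgroup_injective this
  refine (supportDim_le_of_finite (MvPolynomial (Fin d) R)).trans ?_
  rw [Module.supportDim_eq_ringKrullDim_quotient_annihilator]
  have hle : I.map MvPolynomial.C ≤ Module.annihilator (MvPolynomial (Fin d) R) M := by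
    rw [Ideal.map_le_iff_le_comap]
    intro a ha
    rw [Ideal.mem_comap, Module.mem_annihilator]
    intro m
    rw [hC, hI a ha]
  refine (ringKrullDim_le_of_surjective _ (Ideal.Quotient.factor_surjective hle)).trans ?_
  rw [← ringKrullDim_eq_of_ringEquiv
    (MvPolynomial.quotientEquivQuotientMvPolynomial (σ := Fin d) I).toRingEquiv,
    MvPolynomial.ringKrullDim_of_isNoetherianRing, Nat.card_fin]

theorem ringKrullDim_quotient_le_zero {R : Type*} [CommRing R] [IsLocalRing R] {I : Ideal R}
    (hI : IsLocalRing.maximalIdeal R ≤ I.radical) : ringKrullDim (R ⧸ I) ≤ 0 := by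
  rw [ringKrullDim_quotient, Order.krullDim_nonpos_iff_forall_isMax]
  rintro ⟨p, hp⟩ ⟨q, hq⟩ -
  have h1 : IsLocalRing.maximalIdeal R ≤ p.asIdeal :=
    hI.trans ((Ideal.IsPrime.radical_le_iff p.isPrime).2 hp)
  exact (IsLocalRing.le_maximalIdeal q.isPrime.ne_top).trans h1

/-- A descending chain of submodules between `T` and `S` stabilizes if `S / T` is Artinian. -/
theorem exists_forall_le_sup_of_isArtinian {A M : Type*} [CommRing A] [AddCommGroup M] [Module A M]
    {S T : Submodule A M} [IsArtinian A (SubQuotient S T)] {Q : ℕ → Submodule A M}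
    (hT : ∀ n, T ≤ Q n) (hQ : Antitone Q) :
    ∃ N, ∀ n ≥ N, ∀ k ≥ n, ∀ p ∈ S, p ∈ Q n → p ∈ Q k := by
  let q : S →ₗ[A] SubQuotient S T := (T.submoduleOf S).mkQ
  obtain ⟨N, hN⟩ := IsArtinian.monotone_stabilizes (R := A) (M := SubQuotient S T)
    ⟨fun n => OrderDual.toDual (((Q n).submoduleOf S).map q),
      fun _ _ hmn => Submodule.map_mono (Submodule.comap_mono (hQ hmn))⟩
  refine ⟨N, fun n hn k hk p hpS hp => ?_⟩
  have h1 : ((Q n).submoduleOf S).map q = ((Q k).submoduleOf S).map q :=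
    (hN n hn).symm.trans (hN k (hn.le.trans hk))
  have h2 : q ⟨p, hpS⟩ ∈ ((Q k).submoduleOf S).map q := h1 ▸ Submodule.mem_map_of_mem hp
  obtain ⟨⟨p', hp'S⟩, hp', heq⟩ := h2
  have h3 := (Submodule.Quotient.eq (T.submoduleOf S)).1 heq
  have h4 := (Q k).sub_mem hp' (hT k h3)
  simpa using h4

variable {R : Type u} [CommRing R] {K : Ideal R} {Φ : K.Filtration R} {x : ℕ → R} {d : ℕ}
  (hxK : ∀ k, x k ∈ K)

theorem addSubgroup_eq_top_of_single_mem {T : Submodule (reesAlgebra K) (PolynomialModule R R)}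
    {N : AddSubgroup (SubQuotient Φ.submodule T)}
    (hN : ∀ n f (hf : f ∈ Φ.N n), subQuotientMk Φ.submodule T (single R n f) (single_mem Φ hf) ∈ N) :
    N = ⊤ := by
  rw [eq_top_iff]
  rintro z -
  obtain ⟨p, hp, rfl⟩ := exists_subQuotientMk z
  have h1 := hp
  rw [← Submodule.mem_toAddSubmonoid, ← Ideal.Filtration.submodule_closure_single] at h1
  induction h1 using AddSubmonoid.closure_induction with
  | mem p h =>
    obtain ⟨n, f, hf, rfl⟩ := Set.mem_iUnion.1 h
    exact hN n f hf
  | zero => rw [subQuotientMk_eq_zero.2 (Submodule.zero_mem _)]; exact N.zero_mem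
  | add p q hp' hq' ihp ihq =>
    rw [← Submodule.mem_toAddSubmonoid, ← Ideal.Filtration.submodule_closure_single] at hp
    have h2 : ∀ {p}, p ∈ AddSubmonoid.closure (⋃ i, single R i '' (Φ.N i : Set R)) →
      p ∈ Φ.submodule := fun h => by rwa [Ideal.Filtration.submodule_closure_single] at h
    rw [subQuotientMk_add (h2 hp') (h2 hq')]
    exact N.add_mem (ihp _) (ihq _)

theorem coeff_algebraMap_smul (a : R) (p : PolynomialModule R R) (n : ℕ) :
    (algebraMap R (reesAlgebra K) a • p).coeff n = a * p.coeff n := by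
  have : algebraMap R (reesAlgebra K) a • p = Polynomial.monomial 0 a • p := rfl
  rw [this, monomial_smul_apply, if_pos n.zero_le]
  rfl

include hxK in
-- The module is killed by K, with R/K of dimension at most zero, and stability lets the x_i t
-- generate everything from finitely many elements of low degree.
theorem supportDim_assocGraded_le [IsNoetherianRing R] [IsLocalRing R]
    (h : IsSuperficialFiltration Φ.N x d) (hrad : IsLocalRing.maximalIdeal R ≤ K.radical) :
    Module.supportDim (reesAlgebra K) (AssocGraded Φ) ≤ d := by
  obtain ⟨N, hN⟩ := h.stable
  choose g hgfin hg using fun n => Submodule.fg_def.1 (IsNoetherian.noetherian (Φ.N n))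
  let mk : ∀ n (f : Φ.N n), AssocGraded Φ := fun n f =>
    subQuotientMk Φ.submodule (shift Φ).submodule (single R n f) (single_mem Φ f.2)
  refine (supportDim_le_add (I := K) ?_ (fun i : Fin d => initialForm hxK i)
    (s := ⋃ n ∈ Set.Iic N, mk n '' (Subtype.val ⁻¹' (g n))) ?_ ?_).trans ?_
  · intro a ha z
    obtain ⟨p, hp, rfl⟩ := exists_subQuotientMk z
    rw [← subQuotientMk_smul, subQuotientMk_eq_zero]
    intro n
    rw [coeff_algebraMap_smul]
    exact Φ.smul_le n (Submodule.smul_mem_smul ha (hp n))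
  · refine Set.Finite.biUnion (Set.finite_Iic N) fun n _ => ((hgfin n).preimage ?_).image _
    exact Subtype.val_injective.injOn
  · intro L hs hL hy
    let D : ℕ → Ideal R := fun n =>
      { carrier := {f | ∃ hf : f ∈ Φ.N n, mk n ⟨f, hf⟩ ∈ L}
        add_mem' := by
          rintro f f' ⟨hf, hfL⟩ ⟨hf', hfL'⟩
          refine ⟨add_mem hf hf', ?_⟩
          have h1 := L.add_mem hfL hfL'
          rw [← subQuotientMk_add] at h1
          simpa only [mk, single_add] using h1
        zero_mem' := by
          refine ⟨Submodule.zero_mem _, ?_⟩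
          have h1 : mk n ⟨0, Submodule.zero_mem _⟩ = 0 :=
            subQuotientMk_eq_zero.2 (by rw [single_zero]; exact Submodule.zero_mem _)
          rw [h1]
          exact L.zero_mem
        smul_mem' := by
          rintro a f ⟨hf, hfL⟩
          refine ⟨Submodule.smul_mem _ a hf, ?_⟩
          have h1 := hL a _ hfL
          rw [← subQuotientMk_smul] at h1
          have h2 : algebraMap R (reesAlgebra K) a • single R n f = single R n (a • f) := by
            change Polynomial.monomial 0 a • single R n f = _
            rw [monomial_smul_single, zero_add]
          simpa only [mk, h2] using h1 }
    have hD : ∀ n, Φ.N n ≤ D n := by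
      have hD' : ∀ n ≤ N, Φ.N n ≤ D n := fun n hn => by
        rw [← hg n, Submodule.span_le]
        intro f hf
        refine ⟨hg n ▸ Submodule.subset_span hf, hs ?_⟩
        exact Set.mem_biUnion hn ⟨_, hf, rfl⟩
      intro n
      induction n with
      | zero => exact hD' 0 N.zero_le
      | succ n ih =>
        by_cases hn : n + 1 ≤ N
        · exact hD' _ hn
        refine (hN n (by omega)).trans ?_
        rw [partialIdeal, ← Ideal.span_eq (Φ.N n), Ideal.span_mul_span', Ideal.span_le]
        rintro _ ⟨_, ⟨k, hk, rfl⟩, f, hf, rfl⟩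
        obtain ⟨_, hfL⟩ := ih hf
        refine ⟨h.mul_mem k hk n f hf, ?_⟩
        have h1 := hy ⟨k, hk⟩ _ hfL
        rw [← subQuotientMk_smul] at h1
        have h2 : initialForm hxK k • single R n f = single R (n + 1) (x k * f) := by
          change Polynomial.monomial 1 (x k) • single R n f = _
          rw [monomial_smul_single, add_comm 1 n, smul_eq_mul]
        simpa only [mk, h2] using h1
    refine addSubgroup_eq_top_of_single_mem fun n f hf => ?_
    obtain ⟨_, h1⟩ := hD n hf
    exact h1
  · calc _ ≤ (0 : WithBot ℕ∞) + d := by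
          gcongr
          exact ringKrullDim_quotient_le_zero hrad
      _ = d := zero_add _

theorem supportDim_subQuotient_initialSubmodule_add_le [IsNoetherianRing R]
    (h : IsSuperficialFiltration Φ.N x d) (hst : Φ.Stable) {r : ℕ} (hr : r ≤ d)
    (hC : ∀ k < r, RegularInitialForm Φ.N x k) :
    Module.supportDim (reesAlgebra K) (SubQuotient Φ.submodule (initialSubmodule Φ hxK r)) + r ≤
      Module.supportDim (reesAlgebra K) (AssocGraded Φ) := by
  induction r with
  | zero => rw [Nat.cast_zero, add_zero]; exact le_rfl
  | succ r ih =>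
    refine le_trans ?_ (ih (by omega) fun k hk => hC k (by omega))
    have hfin := finite_initialQuotient hxK hst r
    have h1 := supportDim_quotSMulTop_succ_le
      (isSMulRegular_initialForm hxK h hr fun i hi => hC i (by omega))
    rw [Module.supportDim_eq_of_equiv (quotSMulTopSubQuotientEquiv (initialSubmodule_le hxK r) _)]
      at h1
    rw [Nat.cast_succ, add_comm (r : WithBot ℕ∞) 1, ← add_assoc]
    gcongr
    exact h1

variable [IsNoetherianRing R] [IsLocalRing R]

include hxK in
-- Otherwise the quotient by r regular initial forms would be Artinian, so zero in large degrees.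
-- Nakayama then gives F_n ⊆ L_r for some n, whereas x_r^n ∈ F_n and x_r is regular modulo the
-- proper ideal L_r.
theorem lt_supportDim_assocGraded (h : IsSuperficialFiltration Φ.N x d) (hst : Φ.Stable)
    (hΦ : Φ.N 1 ≤ IsLocalRing.maximalIdeal R) {r : ℕ} (hr : r < d)
    (hC : ∀ k < r, RegularInitialForm Φ.N x k) :
    (r : WithBot ℕ∞) < Module.supportDim (reesAlgebra K) (AssocGraded Φ) := by
  by_contra hcon
  have h1 := (supportDim_subQuotient_initialSubmodule_add_le hxK h hst hr.le hC).trans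
    (not_lt.1 hcon)
  have h2 : Module.supportDim (reesAlgebra K)
      (SubQuotient Φ.submodule (initialSubmodule Φ hxK r)) ≤ 0 := by
    exact ENat.WithBot.add_le_add_natCast_right_iff.1 (h1.trans (zero_add _).ge)
  have hfin := finite_initialQuotient hxK hst r
  have hart := isArtinian_of_supportDim_le_zero h2
  -- Elements whose coefficients in degrees below n vanish modulo F_{i+1} + L_r; the chain
  -- stabilizes in the Artinian quotient.
  let Q : ℕ → Submodule (reesAlgebra K) (PolynomialModule R R) := fun n =>
    { carrier := {p | ∀ i < n, p.coeff i ∈ Φ.N (i + 1) ⊔ partialIdeal x r}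
      add_mem' := fun ha hb i hi => (Φ.N (i + 1) ⊔ partialIdeal x r).add_mem (ha i hi) (hb i hi)
      zero_mem' := fun i _ => (Φ.N (i + 1) ⊔ partialIdeal x r).zero_mem
      smul_mem' := fun a p hp i hi => by
        rw [coeff_reesAlgebra_smul]
        refine Submodule.sum_mem _ fun j hj => ?_
        have hj' : j.1 + j.2 = i := Finset.HasAntidiagonal.mem_antidiagonal.1 hj
        obtain ⟨f, hf, l, hl, hfl⟩ := Submodule.mem_sup.1 (hp j.2 (by omega))
        rw [← hfl, mul_add]
        refine Submodule.add_mem_sup ?_ (Ideal.mul_mem_left _ _ hl)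
        have h4 := Φ.pow_smul_le j.1 (j.2 + 1) (Submodule.smul_mem_smul (a.2 j.1) hf)
        rwa [← add_assoc, hj'] at h4 }
  have hQ : ∀ n, initialSubmodule Φ hxK r ≤ Q n := fun n p hp i _ =>
    coeff_mem_of_mem_initialSubmodule hxK hp i
  obtain ⟨N, hN⟩ := exists_forall_le_sup_of_isArtinian (S := Φ.submodule) hQ
    (antitone_nat_of_succ_le fun n p hp i hi => hp i (by omega))
  obtain ⟨N', hN'⟩ := h.stable
  have h3 : ∀ n ≥ N, Φ.N n ≤ Φ.N (n + 1) ⊔ partialIdeal x r := by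
    intro n hn f hf
    have h4 : single R n f ∈ Q n := fun i hi => by
      rw [coeff_single, Finsupp.single_eq_of_ne (by omega)]
      exact Submodule.zero_mem _
    have h5 := hN n hn (n + 1) (by omega) _ (single_mem Φ hf) h4 n n.lt_succ_self
    rwa [coeff_single, Finsupp.single_eq_same] at h5
  set n := max N N' with hn
  have h4 : Φ.N n ≤ partialIdeal x r := by
    refine Submodule.le_of_le_smul_of_le_jacobson_bot (I := IsLocalRing.maximalIdeal R)
      (IsNoetherian.noetherian _) (IsLocalRing.maximalIdeal_le_jacobson _) ?_
    rw [sup_comm]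
    refine (h3 n (le_max_left _ _)).trans (sup_le_sup_right ?_ _)
    exact (hN' n (le_max_right _ _)).trans (Ideal.mul_mono_left (h.partialIdeal_le.trans hΦ))
  have h5 : x r ^ n ∈ Φ.N n := by
    have := h.pow_mul_mem_sup hr (n := 0) (r := 1) (L := ⊥) (by rw [h.zero]; simp) n
    simpa using this
  have h6 : ∀ k, x r ^ k ∈ partialIdeal x r → (1 : R) ∈ partialIdeal x r := by
    intro k
    induction k with
    | zero => intro hk; simpa using hk
    | succ k ih => exact fun hk => ih (h.regular r hr _ (by rwa [← pow_succ']))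
  exact (Ideal.ne_top_iff_one _).1 (IsLocalRing.maximalIdeal.isMaximal R).ne_top
    (((partialIdeal_mono x hr.le).trans h.partialIdeal_le).trans hΦ (h6 n (h4 h5)))

include hxK in
theorem le_depth_assocGraded_iff (h : IsSuperficialFiltration Φ.N x d) (hst : Φ.Stable)
    (hΦ : Φ.N 1 ≤ IsLocalRing.maximalIdeal R) (hK : K ≤ IsLocalRing.maximalIdeal R)
    (hrad : IsLocalRing.maximalIdeal R ≤ K.radical) {m : ℕ} (hm : m ≤ d) :
    (m : ℕ∞) ≤ depth (reesMaximalIdeal K) (AssocGraded Φ) ↔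
      ∀ k < m, RegularInitialForm Φ.N x k := by
  constructor
  · intro hle
    rcases m with _ | m
    · simp
    -- Depth is a supremum; a strict inequality is needed to extract a sequence.
    have h1 : (m : ℕ∞) < depth (reesMaximalIdeal K) (AssocGraded Φ) :=
      lt_of_lt_of_le (by exact_mod_cast m.lt_succ_self) hle
    obtain ⟨⟨rs, hmem, hrs⟩, hlen⟩ := lt_iSup_iff.1 h1
    exact regularInitialForm_of_isRegular hxK h hst hΦ hK hrad hm (by exact_mod_cast hlen) hmem hrs
  · intro hC
    obtain ⟨rs, hlen, hmem, hrs⟩ := exists_isRegular_initialQuotient hxK h hΦ hK hm hC le_rfl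
    rw [Nat.sub_self] at hrs
    rw [← hlen]
    exact le_iSup (fun rs : {rs : List (reesAlgebra K) // (∀ r ∈ rs, r ∈ reesMaximalIdeal K) ∧
      IsRegular (AssocGraded Φ) rs} => (rs.1.length : ℕ∞)) ⟨rs, hmem, hrs⟩

include hxK in
-- The dimension is at most d, and it exceeds the depth whenever the depth is below d.
theorem depth_assocGraded_eq_supportDim_iff (h : IsSuperficialFiltration Φ.N x d) (hst : Φ.Stable)
    (hΦ : Φ.N 1 ≤ IsLocalRing.maximalIdeal R) (hK : K ≤ IsLocalRing.maximalIdeal R)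
    (hrad : IsLocalRing.maximalIdeal R ≤ K.radical) :
    (depth (reesMaximalIdeal K) (AssocGraded Φ) : WithBot ℕ∞) =
        Module.supportDim (reesAlgebra K) (AssocGraded Φ) ↔
      ∀ k < d, RegularInitialForm Φ.N x k := by
  have hdim := supportDim_assocGraded_le hxK h hrad
  rw [← le_depth_assocGraded_iff hxK h hst hΦ hK hrad le_rfl]
  constructor
  · intro heq
    by_contra hlt
    rw [not_le] at hlt
    obtain ⟨r, hr⟩ := ENat.ne_top_iff_exists.1 hlt.ne_top
    rw [← hr] at hlt heq
    have hrd : r < d := by exact_mod_cast hlt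
    refine (lt_supportDim_assocGraded hxK h hst hΦ hrd
      ((le_depth_assocGraded_iff hxK h hst hΦ hK hrad hrd.le).1 hr.le)).ne ?_
    exact heq
  · intro hle
    have hfin : Module.Finite (reesAlgebra K) (AssocGraded Φ) := finite_initialQuotient hxK hst 0
    refine le_antisymm ?_ (hdim.trans ?_)
    · obtain ⟨rs, -, -, hrs⟩ := exists_isRegular_initialQuotient hxK h hΦ hK d.zero_le
        (by simp) le_rfl
      have hnt : Nontrivial (AssocGraded Φ) := hrs.nontrivial
      obtain ⟨s, hs⟩ := WithBot.ne_bot_iff_exists.1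
        (Module.supportDim_ne_bot_of_nontrivial (reesAlgebra K) (AssocGraded Φ))
      rw [← hs, WithBot.coe_le_coe]
      refine iSup_le fun rs => ?_
      rw [← WithBot.coe_le_coe, hs]
      exact length_le_supportDim rs.2.2
    · exact_mod_cast hle

end Dimension

/-! ### Systems of parameters in a Cohen–Macaulay local ring -/

section CohenMacaulay

universe u

open RingTheory.Sequence
open scoped Pointwise

/-- Modulo p only x_k, …, x_{d-1} remain, and they generate an ideal whose quotient has dimension at
most zero. -/
theorem ringKrullDim_quotient_le_of_mem {R : Type*} [CommRing R] [IsNoetherianRing R]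
    [IsLocalRing R] {x : ℕ → R} {d k : ℕ} (hxm : ∀ k, x k ∈ IsLocalRing.maximalIdeal R)
    (hrad : IsLocalRing.maximalIdeal R ≤ (partialIdeal x d).radical) {p : Ideal R} [p.IsPrime]
    (hp : partialIdeal x k ≤ p) : ringKrullDim (R ⧸ p) ≤ (d - k : ℕ) := by
  classical
  have hloc : IsLocalRing (R ⧸ p) :=
    IsLocalRing.of_surjective' (Ideal.Quotient.mk p) Ideal.Quotient.mk_surjective
  have hmax : ∀ a ∈ IsLocalRing.maximalIdeal R,
      Ideal.Quotient.mk p a ∈ IsLocalRing.maximalIdeal (R ⧸ p) := by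
    intro a ha hu
    obtain ⟨b, hb⟩ := hu.exists_right_inv
    obtain ⟨b, rfl⟩ := Ideal.Quotient.mk_surjective b
    rw [← map_mul, ← map_one (Ideal.Quotient.mk p), Ideal.Quotient.eq] at hb
    have h1 := Ideal.sub_mem _ (Ideal.mul_mem_right b _ ha)
      (IsLocalRing.le_maximalIdeal (Ideal.IsPrime.ne_top ‹_›) hb)
    rw [sub_sub_cancel] at h1
    exact (Ideal.ne_top_iff_one _).1 (IsLocalRing.maximalIdeal.isMaximal R).ne_top h1
  let s : Finset (R ⧸ p) := (Finset.Ico k d).image fun j => Ideal.Quotient.mk p (x j)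
  have hs : (s : Set (R ⧸ p)) ⊆ IsLocalRing.maximalIdeal (R ⧸ p) := by
    intro a ha
    obtain ⟨j, -, rfl⟩ := Finset.mem_image.1 (Finset.mem_coe.1 ha)
    exact hmax _ (hxm j)
  have h1 := ringKrullDim_le_ringKrullDim_quotient_add_card s
    (by rwa [IsLocalRing.ringJacobson_eq_maximalIdeal])
  have h2 : ringKrullDim ((R ⧸ p) ⧸ Ideal.span (s : Set (R ⧸ p))) ≤ 0 := by
    refine ringKrullDim_quotient_le_zero fun a ha => ?_
    obtain ⟨a, rfl⟩ := Ideal.Quotient.mk_surjective a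
    have ha' : a ∈ IsLocalRing.maximalIdeal R := fun hu => ha (hu.map _)
    obtain ⟨n, hn⟩ := hrad ha'
    refine ⟨n, ?_⟩
    rw [← map_pow]
    have h3 : (partialIdeal x d).map (Ideal.Quotient.mk p) ≤ Ideal.span (s : Set (R ⧸ p)) := by
      rw [partialIdeal, Ideal.map_span, Ideal.span_le]
      rintro _ ⟨_, ⟨j, hj, rfl⟩, rfl⟩
      by_cases hjk : j < k
      · rw [Ideal.Quotient.eq_zero_iff_mem.2 (hp (mem_partialIdeal x hjk))]
        exact Ideal.zero_mem _
      · exact Ideal.subset_span (Finset.mem_coe.2 (Finset.mem_image_of_mem _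
          (Finset.mem_Ico.2 ⟨not_lt.1 hjk, hj⟩)))
    exact h3 (Ideal.mem_map_of_mem (Ideal.Quotient.mk p) hn)
  calc ringKrullDim (R ⧸ p) ≤ _ := h1
    _ ≤ 0 + (d - k : ℕ) := by
      gcongr
      exact Finset.card_image_le.trans (Nat.card_Ico k d).le
    _ = _ := zero_add _

/-- A system of parameters of a Cohen–Macaulay local ring is a regular sequence. -/
theorem mem_partialIdeal_of_mul_mem {R : Type u} [CommRing R] [IsNoetherianRing R]
    [IsLocalRing R] {x : ℕ → R} {d : ℕ} (hxm : ∀ k, x k ∈ IsLocalRing.maximalIdeal R)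
    (hrad : IsLocalRing.maximalIdeal R ≤ (partialIdeal x d).radical) {rs : List R}
    (hlen : rs.length = d) (hmem : ∀ r ∈ rs, r ∈ IsLocalRing.maximalIdeal R)
    (hrs : IsRegular R rs) :
    ∀ k < d, ∀ r, x k * r ∈ partialIdeal x k → r ∈ partialIdeal x k := by
  -- A zero divisor x_k would lie in an associated prime p of R/L_k. Depth forces dim R/p ≥ d − k,
  -- but p contains k + 1 of the parameters.
  have hreg : ∀ k < d, (∃ rs : List R, rs.length = d - k ∧
      (∀ r ∈ rs, r ∈ IsLocalRing.maximalIdeal R) ∧ IsRegular (R ⧸ partialIdeal x k) rs) →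
      IsSMulRegular (R ⧸ partialIdeal x k) (x k) := by
    rintro k hk ⟨rs, hlen, hmem, hrs⟩
    by_contra hcon
    have h1 : x k ∈ ⋃ p ∈ associatedPrimes R (R ⧸ partialIdeal x k), (p : Set R) := by
      rw [biUnion_associatedPrimes_eq_compl_regular]
      exact hcon
    obtain ⟨p, hp, hxp⟩ := Set.mem_iUnion₂.1 h1
    have hp' : IsAssociatedPrime p (R ⧸ partialIdeal x k) := hp
    have hprime := hp'.isPrime
    have hle : partialIdeal x k ≤ p := by
      have := hp'.annihilator_le
      rwa [Submodule.annihilator_top, Ideal.annihilator_quotient] at this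
    have h2 := (length_le_ringKrullDim_quotient hmem hrs.toIsWeaklyRegular hp').trans
      (ringKrullDim_quotient_le_of_mem (k := k + 1) hxm hrad (by
        rw [partialIdeal_succ]
        exact sup_le hle ((Ideal.span_singleton_le_iff_mem p).2 hxp)))
    rw [hlen] at h2
    have h3 : d - k ≤ d - (k + 1) := by exact_mod_cast h2
    omega
  have key : ∀ k ≤ d, ∃ rs : List R, rs.length = d - k ∧
      (∀ r ∈ rs, r ∈ IsLocalRing.maximalIdeal R) ∧ IsRegular (R ⧸ partialIdeal x k) rs := by
    intro k
    induction k with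
    | zero =>
      intro _
      refine ⟨rs, hlen, hmem, ?_⟩
      exact (LinearEquiv.isRegular_congr
        (Submodule.quotEquivOfEqBot _ (partialIdeal_zero x)) rs).2 hrs
    | succ k ih =>
      intro hk
      obtain ⟨rs, hlen, hmem, hrs⟩ := ih (by omega)
      have htop : IsLocalRing.maximalIdeal R • (⊤ : Submodule R (R ⧸ partialIdeal x k)) ≠ ⊤ := by
        intro htop
        have := hrs.nontrivial
        exact top_ne_bot (Submodule.eq_bot_of_le_smul_of_le_jacobson_bot _ _
          Module.Finite.fg_top htop.ge (IsLocalRing.maximalIdeal_le_jacobson _))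
      obtain ⟨rs', hlen', hmem', hrs'⟩ := exists_isRegular_quotSMulTop htop (by omega : rs.length = d - (k + 1) + 1) hmem hrs
        (hxm k) (hreg k hk ⟨rs, hlen, hmem, hrs⟩)
      refine ⟨rs', hlen', hmem', (LinearEquiv.isRegular_congr
        (quotSMulTopQuotientEquiv _ _ ?_) rs').1 hrs'⟩
      rw [partialIdeal_succ, smul_eq_mul, Ideal.mul_top]
  intro k hk r hr
  exact (isSMulRegular_quotient_iff_mem_of_smul_mem _ _).1 (hreg k hk (key k hk.le)) r hr

theorem IsCohenMacaulayLocalRing.exists_isRegular {R : Type u} [CommRing R] [IsLocalRing R]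
    (h : IsCohenMacaulayLocalRing R) {d : ℕ} (hd : ringKrullDim R = d) :
    ∃ rs : List R, rs.length = d ∧ (∀ r ∈ rs, r ∈ IsLocalRing.maximalIdeal R) ∧
      IsRegular R rs := by
  have h1 : depth (IsLocalRing.maximalIdeal R) R = d := by
    have := h.2
    rw [hd] at this
    exact_mod_cast this
  rw [depth] at h1
  have hne : Nonempty {rs : List R // (∀ r ∈ rs, r ∈ IsLocalRing.maximalIdeal R) ∧
      IsRegular R rs} := ⟨⟨[], by simp, IsRegular.nil R R⟩⟩
  obtain ⟨⟨rs, hmem, hrs⟩, hlen⟩ := ENat.exists_eq_iSup_of_lt_top (h1 ▸ ENat.natCast_lt_top d)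
  rw [h1] at hlen
  exact ⟨rs, by exact_mod_cast hlen, hmem, hrs⟩

end CohenMacaulay

/-! ### The two filtrations of the theorem -/

section Main

universe u

variable {R : Type u} [CommRing R]

namespace IsSuperficialFiltration

variable {F G : ℕ → Ideal R} {x : ℕ → R} {m : ℕ}

/-- The first two Hilbert coefficients of a filtration. -/
theorem hilbertCoeff_eq (h : IsSuperficialFiltration F x (m + 1)) :
    hilbertCoeff (fun n => colength (F (n + 1))) (m + 1) 0 = colength (partialIdeal x (m + 1)) ∧
    hilbertCoeff (fun n => colength (F (n + 1))) (m + 1) 1 = ∑ᶠ j, sectionLength F x m j := by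
  refine hilbertCoeff_of_family
    (H := fun k n => (colength (F (n + 1) ⊔ partialIdeal x k) : ℤ)) ?_ ?_ ?_
  · filter_upwards with n
    rw [partialIdeal_zero, sup_bot_eq]
  · intro k hk
    exact (Filter.tendsto_add_atTop_nat 1).eventually (h.colength_family (by omega))
  · filter_upwards [(Filter.tendsto_add_atTop_nat 1).eventually h.eventually_colength_sup]
      with n hn
    rw [hn]
    push_cast
    ring

/-- The multiplicity of the quotients of two filtrations. -/
theorem hilbertCoeff_relLength_eq (hF : IsSuperficialFiltration F x (m + 1))
    (hG : IsSuperficialFiltration G x (m + 1)) (hle : ∀ n, F (n + 1) ≤ G n) :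
    hilbertCoeff (fun n => relLength (G n) (F (n + 1))) m 0 =
      colength (partialIdeal x (m + 1)) + ∑ᶠ j, sectionLength G x m j -
        ∑ᶠ j, sectionLength F x m j := by
  -- F is taken one degree ahead of G, which leaves one extra ℓ(R/J) in the constant.
  refine hilbertCoeff_zero_of_family (H := fun k n =>
    (colength (F (n + 1) ⊔ partialIdeal x k) : ℤ) - colength (G n ⊔ partialIdeal x k)) ?_ ?_ ?_
  · filter_upwards with n
    rw [partialIdeal_zero, sup_bot_eq, sup_bot_eq, colength_eq_add (hF.finite _) (hle n)]
    push_cast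
    ring
  · intro k hk
    filter_upwards [(Filter.tendsto_add_atTop_nat 1).eventually (hF.colength_family (k := k)
      (by omega)), hG.colength_family (k := k) (by omega)] with n h1 h2
    rw [h1, h2]
    ring
  · filter_upwards [(Filter.tendsto_add_atTop_nat 1).eventually hF.eventually_colength_sup,
      hG.eventually_colength_sup] with n h1 h2
    rw [h1, h2]
    push_cast
    ring

theorem finite_relLength_ne_zero (h : IsSuperficialFiltration F x (m + 1)) :
    {n | relLength (F (n + 2)) (partialIdeal x (m + 1) * F (n + 1)) ≠ 0}.Finite := by
  have h1 : ∀ᶠ n in Filter.cofinite,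
      relLength (F (n + 2)) (partialIdeal x (m + 1) * F (n + 1)) = 0 := by
    rw [Nat.cofinite_eq_atTop]
    filter_upwards [(Filter.tendsto_add_atTop_nat 1).eventually h.eventually_eq_mul] with n hn
    have h2 := colength_eq_add (h.finiteColength_mul (n + 1)) (h.mul_le (n + 1))
    rw [← hn] at h2 ⊢
    change colength (F (n + 2)) = relLength (F (n + 2)) (F (n + 2)) + colength (F (n + 2)) at h2
    change relLength (F (n + 2)) (F (n + 2)) = 0
    omega
  exact h1

/-- The term j = 0 is ℓ(F₁/J), split off because F₀ = R. -/
theorem finsum_colength_mul_sub (h : IsSuperficialFiltration F x (m + 1)) :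
    ∑ᶠ j, ((colength (partialIdeal x (m + 1) * F j) : ℤ) - colength (F (j + 1))) =
      colength (partialIdeal x (m + 1)) - colength (F 1) +
        ∑ᶠ n, (relLength (F (n + 2)) (partialIdeal x (m + 1) * F (n + 1)) : ℤ) := by
  have h1 : ∀ j, (colength (partialIdeal x (m + 1) * F j) : ℤ) - colength (F (j + 1)) =
      relLength (F (j + 1)) (partialIdeal x (m + 1) * F j) := fun j => by
    rw [colength_eq_add (h.finiteColength_mul j) (h.mul_le j)]
    push_cast
    ring
  obtain ⟨N, hN⟩ := h.finite_relLength_ne_zero.bddAbove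
  have h2 : ∀ n, N < n → relLength (F (n + 2)) (partialIdeal x (m + 1) * F (n + 1)) = 0 :=
    fun n hn => by
      by_contra hne
      exact absurd (hN hne) (by omega)
  rw [finsum_eq_sum_of_support_subset (s := Finset.range (N + 2)) _ ?_,
    finsum_eq_sum_of_support_subset (s := Finset.range (N + 1)) _ ?_, Finset.sum_range_succ',
    h.zero, Ideal.mul_top, add_comm]
  · congr 1
    exact Finset.sum_congr rfl fun j _ => h1 (j + 1)
  · intro n hn
    by_contra hlt
    refine hn ?_
    exact congrArg Nat.cast (h2 n (by simpa using hlt))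
  · intro n hn
    by_contra hlt
    refine hn ((h1 n).trans ?_)
    have hlt' : N + 2 ≤ n := by simpa using hlt
    obtain ⟨k, rfl⟩ : ∃ k, n = k + 1 := ⟨n - 1, by omega⟩
    rw [h2 k (by omega), Nat.cast_zero]

end IsSuperficialFiltration

/-- Cancellation of a superficial element modulo an ideal. -/
theorem IsSuperficial.exists_forall_mem {I₁ I₂ L : Ideal R} {x : R}
    (h : IsSuperficial (I₂.map (Ideal.Quotient.mk L)) (I₁.map (Ideal.Quotient.mk L))
      (Ideal.Quotient.mk L x)) (hreg : ∀ r, x * r ∈ L → r ∈ L) :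
    ∃ N, ∀ n ≥ N, ∀ s r, x * r ∈ I₁ ^ s * I₂ ^ (n + 1) ⊔ L → r ∈ I₁ ^ s * I₂ ^ n ⊔ L := by
  obtain ⟨-, N, -, hN⟩ := h
  refine ⟨N, fun n hn s r hr => ?_⟩
  have h1 := hN (n + 1) (by omega) s
  rw [Nat.add_sub_cancel, ← Ideal.map_pow, ← Ideal.map_pow, ← Ideal.map_pow, ← Ideal.map_mul,
    ← Ideal.map_mul] at h1
  have h2 : Ideal.Quotient.mk L (x * r) ∈ (I₁ ^ s * I₂ ^ (n + 1)).map (Ideal.Quotient.mk L) := by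
    rwa [Ideal.mem_quotient_iff_mem_sup]
  have h3 : Ideal.Quotient.mk L (x * r) ∈ Ideal.span {Ideal.Quotient.mk L x} *
      (I₁ ^ s * I₂ ^ n).map (Ideal.Quotient.mk L) := by
    rw [← h1]
    refine ⟨?_, h2⟩
    rw [map_mul]
    exact Ideal.mul_mem_right _ _ (Ideal.mem_span_singleton_self _)
  obtain ⟨z, hz, hzr⟩ := Ideal.mem_span_singleton_mul.1 h3
  obtain ⟨c, hc, rfl⟩ := (Ideal.mem_map_iff_of_surjective _ Ideal.Quotient.mk_surjective).1 hz
  rw [← map_mul, Ideal.Quotient.eq, ← mul_sub] at hzr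
  have h4 := Submodule.sub_mem_sup hc (hreg _ hzr)
  rwa [sub_sub_cancel] at h4

/-- Extension of a finite sequence by zero. -/
def extendSeq {d : ℕ} (x : Fin d → R) (k : ℕ) : R := if h : k < d then x ⟨k, h⟩ else 0

theorem extendSeq_of_lt {d : ℕ} (x : Fin d → R) {k : ℕ} (h : k < d) :
    extendSeq x k = x ⟨k, h⟩ := dif_pos h

theorem partialIdeal_extendSeq {d : ℕ} (x : Fin d → R) :
    partialIdeal (extendSeq x) d = Ideal.span (Set.range x) := by
  rw [partialIdeal]
  congr 1
  ext a
  constructor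
  · rintro ⟨k, hk, rfl⟩
    exact ⟨⟨k, hk⟩, (extendSeq_of_lt x hk).symm⟩
  · rintro ⟨k, rfl⟩
    exact ⟨k, k.2, extendSeq_of_lt x k.2⟩

theorem prevIdeal_eq_partialIdeal {d : ℕ} (x : Fin d → R) (k : Fin d) :
    prevIdeal x k = partialIdeal (extendSeq x) k := by
  rw [prevIdeal, partialIdeal]
  congr 1
  ext a
  constructor
  · rintro ⟨j, hj, rfl⟩
    exact ⟨j, hj, extendSeq_of_lt x j.2⟩
  · rintro ⟨j, hj, rfl⟩
    have hj' : j < k := hj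
    exact ⟨⟨j, hj'.trans k.2⟩, hj', (extendSeq_of_lt x _).symm⟩

theorem IsSuperficialSequence.exists_forall_mem {I₁ I₂ : Ideal R} {d : ℕ} {x : Fin d → R}
    (h : IsSuperficialSequence I₂ I₁ x) {k : ℕ} (hk : k < d)
    (hreg : ∀ r, extendSeq x k * r ∈ partialIdeal (extendSeq x) k →
      r ∈ partialIdeal (extendSeq x) k) :
    ∃ N, ∀ n ≥ N, ∀ s r, extendSeq x k * r ∈
      I₁ ^ s * I₂ ^ (n + 1) ⊔ partialIdeal (extendSeq x) k →
      r ∈ I₁ ^ s * I₂ ^ n ⊔ partialIdeal (extendSeq x) k := by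
  have hL : prevIdeal x ⟨k, hk⟩ = partialIdeal (extendSeq x) k := prevIdeal_eq_partialIdeal x _
  rw [← hL, extendSeq_of_lt x hk] at hreg ⊢
  exact (h ⟨k, hk⟩).exists_forall_mem hreg

theorem extendSeq_mem {d : ℕ} {x : Fin d → R} {I : Ideal R} (h : Ideal.span (Set.range x) ≤ I)
    (k : ℕ) : extendSeq x k ∈ I := by
  rw [extendSeq]
  split_ifs with hk
  · exact h (Ideal.subset_span ⟨_, rfl⟩)
  · exact I.zero_mem

theorem IsReduction.exists_forall_mul_eq {J I : Ideal R} (h : IsReduction J I) :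
    ∃ N, ∀ n ≥ N, J * I ^ n = I ^ (n + 1) := by
  obtain ⟨N, hN⟩ := h.2
  refine ⟨N, fun n hn => ?_⟩
  obtain ⟨k, rfl⟩ := Nat.exists_eq_add_of_le hn
  rw [pow_add, ← mul_assoc, hN, ← pow_add]
  congr 1
  omega

theorem IsReduction.le_radical {J I : Ideal R} (h : IsReduction J I) : I ≤ J.radical := by
  obtain ⟨N, hN⟩ := h.2
  intro a ha
  refine ⟨N + 1, ?_⟩
  have h1 : a ^ (N + 1) ∈ J * I ^ N := hN ▸ Ideal.pow_mem_pow ha (N + 1)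
  exact (Ideal.mul_le_left : J * I ^ N ≤ J) h1

variable [IsLocalRing R]

theorem maximalIdeal_le_radical_mul_pow {I J : Ideal R}
    (hI : IsLocalRing.maximalIdeal R ≤ I.radical) (hJ : IsLocalRing.maximalIdeal R ≤ J.radical)
    (n : ℕ) : IsLocalRing.maximalIdeal R ≤ (I * J ^ n).radical := by
  rw [Ideal.radical_mul]
  refine le_inf hI ?_
  rcases eq_or_ne n 0 with rfl | hn
  · rw [pow_zero, Ideal.one_eq_top, Ideal.radical_top]
    exact le_top
  · rwa [Ideal.radical_pow J hn]

variable [IsNoetherianRing R]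

theorem finiteColength_of_maximalIdeal_le_radical {I : Ideal R}
    (hI : IsLocalRing.maximalIdeal R ≤ I.radical) : FiniteColength I := by
  have hart : IsArtinian R (R ⧸ I) := isArtinian_of_supportDim_le_zero
    ((Module.supportDim_quotient_eq_ringKrullDim I).trans_le (ringKrullDim_quotient_le_zero hI))
  have hnoeth : IsNoetherian R (R ⧸ I) := inferInstance
  exact Module.length_ne_top_iff.2
    (isFiniteLength_iff_isNoetherian_isArtinian.2 ⟨hnoeth, hart⟩)

variable {d : ℕ} {x : Fin d → R} {I₁ I₂ : Ideal R}

theorem isSuperficialFiltration_pow (hI₂ : IsLocalRing.maximalIdeal R ≤ I₂.radical)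
    (hred : IsReduction (Ideal.span (Set.range x)) I₂) (hsup : IsSuperficialSequence I₂ I₁ x)
    (hreg : ∀ k < d, ∀ r, extendSeq x k * r ∈ partialIdeal (extendSeq x) k →
      r ∈ partialIdeal (extendSeq x) k) :
    IsSuperficialFiltration (fun n => I₂ ^ n) (extendSeq x) d where
  zero := by rw [pow_zero, Ideal.one_eq_top]
  anti := fun _ _ h => Ideal.pow_le_pow_right h
  mul_mem k _ n r hr := by
    rw [pow_succ']
    exact Ideal.mul_mem_mul (extendSeq_mem hred.1 k) hr
  regular := hreg
  superficial k hk := by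
    obtain ⟨N, hN⟩ := hsup.exists_forall_mem hk (hreg k hk)
    exact ⟨N, fun n hn r hr => by simpa using hN n hn 0 r (by simpa using hr)⟩
  stable := by
    obtain ⟨N, hN⟩ := hred.exists_forall_mul_eq
    refine ⟨N, fun n hn => ?_⟩
    rw [partialIdeal_extendSeq, hN n hn]
  finite n := finiteColength_of_maximalIdeal_le_radical (by
    simpa using maximalIdeal_le_radical_mul_pow (I := ⊤) (by simp [Ideal.radical_top]) hI₂ n)

theorem isSuperficialFiltration_fiberFiltration
    (hI₁ : IsLocalRing.maximalIdeal R ≤ I₁.radical)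
    (hI₂ : IsLocalRing.maximalIdeal R ≤ I₂.radical)
    (hred : IsReduction (Ideal.span (Set.range x)) I₂) (hsup : IsSuperficialSequence I₂ I₁ x)
    (hxI₁ : Ideal.span (Set.range x) ≤ I₁)
    (hreg : ∀ k < d, ∀ r, extendSeq x k * r ∈ partialIdeal (extendSeq x) k →
      r ∈ partialIdeal (extendSeq x) k) :
    IsSuperficialFiltration (fiberFiltration I₁ I₂).N (extendSeq x) d where
  zero := rfl
  anti := antitone_nat_of_succ_le (fiberFiltration I₁ I₂).mono
  mul_mem k _ n r hr := (fiberFiltration I₁ I₂).smul_le n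
    (Submodule.smul_mem_smul (extendSeq_mem (le_inf hxI₁ hred.1) k) hr)
  regular := hreg
  superficial k hk := by
    obtain ⟨N, hN⟩ := hsup.exists_forall_mem hk (hreg k hk)
    -- Superficiality is used with s = 1; F_{n+1} involves only I₂ⁿ, hence the shift of the bound.
    refine ⟨N + 1, fun n hn r hr => ?_⟩
    obtain ⟨n, rfl⟩ : ∃ k, n = k + 1 := ⟨n - 1, by omega⟩
    have h1 := hN n (by omega) 1 r
    rw [pow_one] at h1
    exact h1 hr
  stable := by
    obtain ⟨N, hN⟩ := hred.exists_forall_mul_eq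
    refine ⟨N + 1, fun n hn => ?_⟩
    obtain ⟨n, rfl⟩ : ∃ k, n = k + 1 := ⟨n - 1, by omega⟩
    change I₁ * I₂ ^ (n + 1) ≤ _ * (I₁ * I₂ ^ n)
    rw [partialIdeal_extendSeq, mul_left_comm, hN n (by omega)]
  finite n := finiteColength_of_maximalIdeal_le_radical (by
    rcases n with _ | n
    · exact le_top.trans (Ideal.radical_top R).ge
    · exact maximalIdeal_le_radical_mul_pow hI₁ hI₂ n)

end Main

end FiberCone

/-! ### Assembly of the theorem -/

theorem mainTheorem4 {R : Type*} [CommRing R] [IsLocalRing R]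
    [Infinite (IsLocalRing.ResidueField R)]
    (hCM : FiberCone.IsCohenMacaulayLocalRing R)
    (d : ℕ) (hd : 2 ≤ d) (hdim : ringKrullDim R = d)
    (I₁ I₂ : Ideal R)
    (hI₁ : I₁.radical = IsLocalRing.maximalIdeal R)
    (hI₂ : I₂.radical = IsLocalRing.maximalIdeal R)
    (x : Fin d → R)
    (hred : FiberCone.IsMinimalReduction (Ideal.span (Set.range x)) I₂)
    (hsup : FiberCone.IsSuperficialSequence I₂ I₁ x)
    (hxI₁ : Ideal.span (Set.range x) ≤ I₁)
    (hx : Ideal.span (Set.range x) ⊓ I₁ * I₂ = Ideal.span (Set.range x) * I₁) :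
    (FiberCone.f d I₁ I₂ 0 ≤
        FiberCone.e d I₂ 1 - FiberCone.e d I₂ 0 + (FiberCone.relLength I₂ (I₁ * I₂) : ℤ)
          + (FiberCone.colength I₂ : ℤ) - ((d : ℤ) - 1) * (FiberCone.colength I₁ : ℤ)) ∧
    (FiberCone.f d I₁ I₂ 0 =
        FiberCone.e d I₂ 1 - FiberCone.e d I₂ 0 + (FiberCone.relLength I₂ (I₁ * I₂) : ℤ)
          + (FiberCone.colength I₂ : ℤ) - ((d : ℤ) - 1) * (FiberCone.colength I₁ : ℤ) ↔
      FiberCone.IsCohenMacaulayG I₁ I₂ ∧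
        ∀ n : ℕ, 2 ≤ n →
          I₁ * I₂ ^ n ⊔ Ideal.span (Set.range x) = Ideal.span (Set.range x)) ∧
    {n : ℕ | FiberCone.relLength (I₁ * I₂ ^ (n + 1))
        (Ideal.span (Set.range x) * (I₁ * I₂ ^ n)) ≠ 0}.Finite ∧
    (FiberCone.e d I₂ 1
        - (∑ᶠ n : ℕ, (FiberCone.relLength (I₁ * I₂ ^ (n + 1))
            (Ideal.span (Set.range x) * (I₁ * I₂ ^ n)) : ℤ))
        + (FiberCone.colength I₁ : ℤ) ≤ FiberCone.f d I₁ I₂ 0) ∧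
    (FiberCone.f d I₁ I₂ 0 =
        FiberCone.e d I₂ 1
          - (∑ᶠ n : ℕ, (FiberCone.relLength (I₁ * I₂ ^ (n + 1))
              (Ideal.span (Set.range x) * (I₁ * I₂ ^ n)) : ℤ))
          + (FiberCone.colength I₁ : ℤ) ↔
      ((d - 1 : ℕ) : ℕ∞) ≤ FiberCone.depthG I₁ I₂) := by
  have hnoeth : IsNoetherianRing R := hCM.1
  obtain ⟨m, rfl⟩ : ∃ m, d = m + 1 := ⟨d - 1, by omega⟩
  set J := Ideal.span (Set.range x) with hJ
  set y := FiberCone.extendSeq x with hy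
  have hyJ : FiberCone.partialIdeal y (m + 1) = J := FiberCone.partialIdeal_extendSeq x
  have hJI : J ≤ I₂ := hred.1.1
  have hI₁m : I₁ ≤ IsLocalRing.maximalIdeal R := hI₁ ▸ Ideal.le_radical
  have hJrad : IsLocalRing.maximalIdeal R ≤ J.radical :=
    hI₂.ge.trans (Ideal.radical_le_radical_iff.2 hred.1.le_radical)
  have hym : ∀ k, y k ∈ IsLocalRing.maximalIdeal R := fun k =>
    hI₁m (FiberCone.extendSeq_mem hxI₁ k)
  obtain ⟨rs, hlen, hmem, hrs⟩ := hCM.exists_isRegular hdim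
  have hreg := FiberCone.mem_partialIdeal_of_mul_mem hym (hyJ ▸ hJrad) hlen hmem hrs
  have hF := FiberCone.isSuperficialFiltration_fiberFiltration hI₁.ge hI₂.ge hred.1 hsup hxI₁ hreg
  have hG := FiberCone.isSuperficialFiltration_pow hI₂.ge hred.1 hsup hreg
  have hyK : ∀ k, y k ∈ I₁ ⊓ I₂ := FiberCone.extendSeq_mem (le_inf hxI₁ hJI)
  have hF1 : (FiberCone.fiberFiltration I₁ I₂).N 1 = I₁ := by
    change I₁ * I₂ ^ 0 = I₁
    rw [pow_zero, mul_one]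
  have hF2 : (FiberCone.fiberFiltration I₁ I₂).N 2 = I₁ * I₂ := by
    change I₁ * I₂ ^ 1 = I₁ * I₂
    rw [pow_one]
  have hst : (FiberCone.fiberFiltration I₁ I₂).Stable := by
    obtain ⟨N, hN⟩ := hF.stable
    refine ⟨N, fun n hn => le_antisymm ((FiberCone.fiberFiltration I₁ I₂).smul_le n) ?_⟩
    refine (hN n hn).trans (Ideal.mul_mono_left ?_)
    rw [← hy, hyJ]
    exact le_inf hxI₁ hJI
  have hKm : I₁ ⊓ I₂ ≤ IsLocalRing.maximalIdeal R := inf_le_left.trans hI₁m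
  have hKrad : IsLocalRing.maximalIdeal R ≤ (I₁ ⊓ I₂).radical := by
    rw [Ideal.radical_inf, hI₁, hI₂, inf_idem]
  have hdepth := FiberCone.le_depth_assocGraded_iff hyK hF hst (hF1.trans_le hI₁m) hKm hKrad
    m.le_succ
  have hCMG := FiberCone.depth_assocGraded_eq_supportDim_iff hyK hF hst (hF1.trans_le hI₁m) hKm
    hKrad
  have he0 : FiberCone.e (m + 1) I₂ 0 = FiberCone.colength J := hyJ ▸ hG.hilbertCoeff_eq.1
  have he1 : FiberCone.e (m + 1) I₂ 1 =
      ∑ᶠ j, FiberCone.sectionLength (fun n => I₂ ^ n) y m j := hG.hilbertCoeff_eq.2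
  have hf0 : FiberCone.f (m + 1) I₁ I₂ 0 = FiberCone.colength J +
      ∑ᶠ j, FiberCone.sectionLength (fun n => I₂ ^ n) y m j -
        ∑ᶠ j, FiberCone.sectionLength (FiberCone.fiberFiltration I₁ I₂).N y m j :=
    hyJ ▸ hF.hilbertCoeff_relLength_eq hG
      fun n => (Ideal.mul_le_right : I₁ * I₂ ^ n ≤ I₂ ^ n)
  have hlow := hF.le_finsum_sectionLength
  have hup := hF.finsum_sectionLength_le
  have hsum := hF.finsum_colength_mul_sub
  have hfinite := hF.finite_relLength_ne_zero
  have hJI₁ := FiberCone.finiteColength_of_maximalIdeal_le_radical (R := R) (I := J * I₁)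
    (by rw [Ideal.radical_mul]; exact le_inf hJrad hI₁.ge)
  have hmul := hF.colength_mul_of_le (K := I₁) (by rw [← hy, hyJ]; exact hxI₁)
    (by rw [← hy, hyJ]; exact hJI₁)
  have hI₁I₂ := FiberCone.finiteColength_of_maximalIdeal_le_radical (R := R) (I := I₁ * I₂)
    (by rw [Ideal.radical_mul]; exact le_inf hI₁.ge hI₂.ge)
  -- With J ∩ I₁I₂ = JI₁ and `hmul` this evaluates ℓ(R/(I₁I₂ + J)) as ℓ(R/I₁I₂) − dℓ(R/I₁).
  have hinf := FiberCone.colength_sup_add_colength_inf (I := J) (J := I₁ * I₂)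
    (by rw [hx]; exact hJI₁)
  have hrel := FiberCone.colength_eq_add hI₁I₂ (Ideal.mul_le_right : I₁ * I₂ ≤ I₂)
  rw [← hy, hyJ] at hlow hup hsum hmul hfinite
  rw [hF1] at hlow hsum
  rw [hF2] at hlow
  change _ = (FiberCone.colength J : ℤ) - FiberCone.colength I₁ + ∑ᶠ n : ℕ,
    (FiberCone.relLength (I₁ * I₂ ^ (n + 1)) (J * (I₁ * I₂ ^ n)) : ℤ) at hsum
  rw [hsum] at hup
  rw [hx, sup_comm, hmul] at hinf
  rw [he0, he1, hf0]
  zify at hinf hrel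
  push_cast
  refine ⟨?_, ?_, hfinite, ?_, ?_⟩
  · linarith [hlow.1]
  · refine Iff.trans ⟨fun h => ?_, fun h => ?_⟩ (hlow.2.trans (and_congr hCMG.symm ?_))
    · linarith
    · linarith
    -- F_{n+1} = I₁I₂ⁿ, so n ≥ 3 for F corresponds to n ≥ 2 in the theorem.
    · exact ⟨fun h n hn => h (n + 1) (by omega), fun h n hn => by
        obtain ⟨n, rfl⟩ : ∃ k, n = k + 1 := ⟨n - 1, by omega⟩
        exact h n (by omega)⟩
  · linarith [hup.1]
  · refine Iff.trans ⟨fun h => ?_, fun h => ?_⟩ (hup.2.trans hdepth.symm)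
    · linarith
    · linarith
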